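/- Matroids are finite, and a class of matroids is closed under isomorphism. A \emph{pasture} is a commutative monoid $P$ with absorbing element $0$ whose invertible elements are exactly the nonzero ones, together with an involution $a\mapsto -a$ and a set $N_P$ of formal sums $a+b+c$ (unordered triples of elements of $P$) that is closed under multiplication by elements of $P$ and satisfies $a+b+0\in N_P$ if and only if $b=-a$. Morphisms are multiplicative maps preserving $0$, $1$ and null sums. The category of pastures is cocomplete. Let $M$ be a matroid of rank $r$ on $E$. Its extended Tutte group is the abelian group generated by $-1$ and symbols $T_{\mathbf I}$ for all ordered bases $\mathbf I$ of $M$, with relations $(-1)^2=1$, $T_{\sigma(\mathbf I)}=\operatorname{sign}(\sigma)T_{\mathbf I}$ for permutations $\sigma$, and $T_{\mathbf Iac}T_{\mathbf Ibd}=T_{\mathbf Iad}T_{\mathbf Ibc}$ whenever $Iac,Ibd,Iad,Ibc$ are bases but $Iab$ or $Icd$ is not. The Tutte group is the subgroup generated by $-1$ and all $T_{\mathbf I}/T_{\mathbf J}$, and the inner Tutte group $\mathbb T_M^{(0)}$ is its subgroup of elements of multidegree $0$ in $\mathbb Z^E$, where $\deg T_{\mathbf I}=\sum_{e\in I}\mathbf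 e_e$ and $\deg(-1)=0$. The \emph{foundation} $F_M$ is the pasture with unit group $\mathbb T_M^{(0)}$ whose null set is generated by $$\left[\begin{smallmatrix}a&b\\c&d\end{smallmatrix}\right]_I+\left[\begin{smallmatrix}a&c\\b&d\end{smallmatrix}\right]_I-1,\qquad \left[\begin{smallmatrix}a&b\\c&d\end{smallmatrix}\right]_I=\frac{T_{\mathbf Iac}T_{\mathbf Ibd}}{T_{\mathbf Iad}T_{\mathbf Ibc}},$$ for all $(r-2)$-subsets $I\subset E$ and $a,b,c,d\in E$ such that $Iab,Iac,Iad,Ibc,Ibd,Icd$ are bases, where $\mathbf I$ is any ordering of $I$. An \emph{embedded minor} of $M$ is a minor $M\setminus I/J$ with a fixed choice of disjoint subsets $I,J\subset E$ such that $I$ is coindependent and $J$ is independent. For two embedded minors $N=M\setminus I/J$ and $N'=M\setminus I'/J'$ of $M$ there is a (unique, tautological) minor embedding $N\hookrightarrow N'$ if $I'\subset I$ and $J'\subset J$, and none otherwise. A minor embedding induces a morphism $F_N\to F_{N'}$, which sends $\left[\begin{smallmatrix}a&b\\c&d\end{smallmatrix}\right]_{K}$ to $\left[\begin{smallmatrix}a&b\\c&d\end{smallmatrix}\right]_{K\cup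 (J\setminus J')}$; similarly there is a morphism $F_N\to F_M$. For a family $\mathcal D$ of isomorphism types of matroids, let $\mathcal E_{M,\mathcal D}$ be the diagram of all embedded minors of $M$ with isomorphism type in $\mathcal D$ together with all minor embeddings between them, and let $\mathcal E^<_{M,\mathcal D}$ be its full subdiagram of all $N\neq M$. Let $$\Omega_{M,\mathcal D}:\operatorname{colim}F(\mathcal E_{M,\mathcal D})\to F_M,\qquad \Omega^<_{M,\mathcal D}:\operatorname{colim}F(\mathcal E^<_{M,\mathcal D})\to F_M$$ be the canonical morphisms. For a class $\mathcal C$ of matroids, a \emph{fundamental type} of $\mathcal C$ is an inclusion-minimal family $\mathcal C_0$ of isomorphism types of matroids in $\mathcal C$ such that $\Omega_{M,\mathcal C_0}$ is an isomorphism for all $M\in\mathcal C$. \textbf{Theorem.} Every class $\mathcal C$ of matroids has a unique fundamental type $\mathcal C_{\mathrm{fund}}$. It consists of the isomorphism types of exactly those matroids $M$ in $\mathcal C$ for which $\Omega^<_{M,\mathcal C}:\operatorname{colim}F(\mathcal E^<_{M,\mathcal C})\to F_M$ is not an isomorphism. -/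

import Mathlib

open CategoryTheory CategoryTheory.Limits

universe u v w

noncomputable section

/-! ### Pastures -/

/-- A pasture: a commutative pointed monoid whose invertible elements are exactly the nonzero
elements, with an involution `neg` and a null set, which is an `S₃`-invariant set of triples
(equivalently, a set of formal sums `a + b + c`).  The null set is automatically nonempty since it
contains `1 + neg 1 + 0`. -/
structure Pasture : Type (u + 1) where
  carrier : Type u
  [str : CommGroupWithZero carrier]
  neg : carrier → carrier
  /-- `null a b c` says that `a + b + c` belongs to the null set. -/
  null : carrier → carrier → carrier → Prop
  neg_neg : ∀ a, neg (neg a) = a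
  null_rotate : ∀ a b c, null a b c → null b c a
  null_swap : ∀ a b c, null a b c → null b a c
  null_mul : ∀ d a b c, null a b c → null (d * a) (d * b) (d * c)
  null_zero_iff : ∀ a b, null a b 0 ↔ b = neg a

attribute [instance] Pasture.str

namespace Pasture

/-- A morphism of pastures: a morphism of pointed monoids that maps null sums to null sums. -/
@[ext]
structure Hom (P Q : Pasture.{u}) where
  toMap : P.carrier →*₀ Q.carrier
  map_null : ∀ a b c, P.null a b c → Q.null (toMap a) (toMap b) (toMap c)

instance : Category Pasture.{u} where
  Hom := Hom
  id P := ⟨MonoidWithZeroHom.id _, fun _ _ _ h => h⟩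
  comp f g := ⟨g.toMap.comp f.toMap, fun _ _ _ h => g.map_null _ _ _ (f.map_null _ _ _ h)⟩

theorem hom_ext {P Q : Pasture.{u}} {f g : P ⟶ Q} (h : ∀ a, f.toMap a = g.toMap a) : f = g :=
  Hom.ext (MonoidWithZeroHom.ext h)

theorem comp_apply {P Q R : Pasture.{u}} (f : P ⟶ Q) (g : Q ⟶ R) (a : P.carrier) :
    (f ≫ g).toMap a = g.toMap (f.toMap a) := rfl

theorem id_apply {P : Pasture.{u}} (a : P.carrier) :
    (𝟙 P : P ⟶ P).toMap a = a := rfl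

theorem neg_eq (P : Pasture.{u}) (a : P.carrier) : P.neg a = P.neg 1 * a := by
  have h := P.null_mul a 1 (P.neg 1) 0 ((P.null_zero_iff _ _).2 rfl)
  rw [mul_one, mul_zero, P.null_zero_iff] at h
  rw [← h, mul_comm]

theorem neg_one_sq (P : Pasture.{u}) : P.neg 1 * P.neg 1 = 1 := by
  rw [← P.neg_eq, P.neg_neg]

theorem neg_one_ne_zero (P : Pasture.{u}) : P.neg 1 ≠ 0 := by
  intro h
  have := P.neg_one_sq
  rw [h, mul_zero] at this
  exact zero_ne_one this

/-- The element `-1` as a unit. -/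
def negOne (P : Pasture.{u}) : P.carrierˣ := Units.mk0 (P.neg 1) P.neg_one_ne_zero

theorem Hom.map_neg {P Q : Pasture.{u}} (f : Hom P Q) (a : P.carrier) :
    f.toMap (P.neg a) = Q.neg (f.toMap a) := by
  have h := f.map_null _ _ _ ((P.null_zero_iff a _).2 rfl)
  rwa [map_zero, Q.null_zero_iff] at h

/-! ### The pasture generated by a group, an element `-1` and three-term relations -/

section Generate

variable {G : Type u} [CommGroup G]

/-- The smallest null set on `G ∪ {0}` with `-1 = ε` that contains all `a + b + c` with
`S a b c`. -/
inductive GenNull (ε : G) (S : G → G → G → Prop) :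
    WithZero G → WithZero G → WithZero G → Prop
  | pair (a : WithZero G) : GenNull ε S a (ε * a) 0
  | triple (d : WithZero G) (a b c : G) (h : S a b c) : GenNull ε S (d * a) (d * b) (d * c)
  | rotate (a b c : WithZero G) (h : GenNull ε S a b c) : GenNull ε S b c a
  | swap (a b c : WithZero G) (h : GenNull ε S a b c) : GenNull ε S b a c

theorem GenNull.zero {ε : G} (hε : ε * ε = 1) {S : G → G → G → Prop} {a b c : WithZero G}
    (h : GenNull ε S a b c) :
    (a = 0 → c = ε * b) ∧ (b = 0 → c = ε * a) ∧ (c = 0 → b = ε * a) := by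
  have hε' : (ε : WithZero G) * ε = 1 := by exact_mod_cast hε
  have key : ∀ x y : WithZero G, x = ε * y → y = ε * x := by
    intro x y h
    rw [h, ← mul_assoc, hε', one_mul]
  induction h with
  | pair a =>
    refine ⟨?_, ?_, fun _ => rfl⟩
    · rintro rfl; simp
    · intro h
      have : a = 0 := by simpa using h
      simp [this]
  | triple d a b c h =>
    refine ⟨?_, ?_, ?_⟩ <;>
    · intro h
      have : d = 0 := by simpa using h
      simp [this]
  | rotate a b c _ ih =>
    exact ⟨fun h => key _ _ (ih.2.1 h), fun h => key _ _ (ih.2.2 h), fun h => ih.1 h⟩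
  | swap a b c _ ih =>
    exact ⟨ih.2.1, ih.1, fun h => key _ _ (ih.2.2 h)⟩

/-- The pasture with unit group `G`, with `-1 = ε`, and with null set generated by `S`. -/
def generate (ε : G) (hε : ε * ε = 1) (S : G → G → G → Prop) : Pasture.{u} where
  carrier := WithZero G
  neg a := ε * a
  null := GenNull ε S
  neg_neg a := by
    have hε' : (ε : WithZero G) * ε = 1 := by exact_mod_cast hε
    rw [← mul_assoc, hε', one_mul]
  null_rotate := GenNull.rotate
  null_swap := GenNull.swap
  null_mul d a b c h := by
    induction h with
    | pair a =>
      have := GenNull.pair (ε := ε) (S := S) (d * a)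
      rwa [← mul_assoc, mul_comm (ε : WithZero G) d, mul_assoc, ← mul_zero d] at this
    | triple e a b c h =>
      have := GenNull.triple (ε := ε) (S := S) (d * e) a b c h
      simpa only [mul_assoc] using this
    | rotate a b c _ ih => exact ih.rotate
    | swap a b c _ ih => exact ih.swap
  null_zero_iff a b := by
    refine ⟨fun h => (h.zero hε).2.2 rfl, ?_⟩
    rintro rfl
    exact GenNull.pair a

variable {ε : G} {hε : ε * ε = 1} {S : G → G → G → Prop}

/-- Morphisms out of `generate ε hε S` are induced by group homomorphisms respecting `ε`, `S`. -/
def generateDesc {Q : Pasture.{u}} (φ : G →* Q.carrier) (h1 : φ ε = Q.neg 1)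
    (h2 : ∀ a b c, S a b c → Q.null (φ a) (φ b) (φ c)) : generate ε hε S ⟶ Q where
  toMap := WithZero.lift' φ
  map_null a b c h := by
    change GenNull ε S a b c at h
    induction h with
    | pair a =>
      have h3 : WithZero.lift' φ (ε * a) = Q.neg (WithZero.lift' φ a) := by
        rw [map_mul, WithZero.lift'_coe, h1, ← Q.neg_eq]
      have h4 : WithZero.lift' φ (0 : WithZero G) = 0 := map_zero _
      exact h4.symm ▸ (Q.null_zero_iff _ _).2 h3
    | triple d a b c h =>
      have := Q.null_mul (WithZero.lift' φ d) _ _ _ (h2 _ _ _ h)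
      have hm : ∀ x : G, WithZero.lift' φ (d * x) = WithZero.lift' φ d * φ x := fun x => by
        rw [map_mul, WithZero.lift'_coe]
      rw [← hm, ← hm, ← hm] at this
      exact this
    | rotate a b c _ ih => exact Q.null_rotate _ _ _ ih
    | swap a b c _ ih => exact Q.null_swap _ _ _ ih

open Classical in
/-- The extension of a homomorphism on unit groups by `0 ↦ 0`. -/
def extendUnits {P : Pasture.{u}} (φ : P.carrierˣ →* G) : P.carrier →*₀ WithZero G :=
  (WithZero.map' φ).comp
    (WithZero.withZeroUnitsEquiv (G := P.carrier)).symm.toMonoidWithZeroHom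

theorem extendUnits_apply {P : Pasture.{u}} (φ : P.carrierˣ →* G) (x : P.carrierˣ) :
    extendUnits φ (x : P.carrier) = (φ x : WithZero G) := by
  classical
  change WithZero.map' φ (WithZero.withZeroUnitsEquiv.symm (x : P.carrier)) = _
  rw [WithZero.withZeroUnitsEquiv_symm_apply_coe, WithZero.map'_coe]

/-- Morphisms into `generate ε hε S` from group homomorphisms on unit groups. -/
def generateLift {P : Pasture.{u}} (φ : P.carrierˣ →* G) (h1 : φ P.negOne = ε)
    (h2 : ∀ a b c : P.carrierˣ, P.null a b c → S (φ a) (φ b) (φ c)) :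
    P ⟶ generate ε hε S where
  toMap := extendUnits φ
  map_null a b c h := by
    set ψ : P.carrier →*₀ WithZero G := extendUnits φ with hψ
    have hu : ∀ x : P.carrierˣ, ψ x = (φ x : WithZero G) := extendUnits_apply φ
    have hneg : ∀ x, ψ (P.neg x) = ε * ψ x := by
      intro x
      rw [P.neg_eq, map_mul, show P.neg 1 = (P.negOne : P.carrier) from rfl, hu, h1]
    have hz : ∀ a b, P.null a b 0 → GenNull ε S (ψ a) (ψ b) (ψ 0) := by
      intro a b h
      rw [(P.null_zero_iff _ _).1 h, hneg, map_zero]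
      exact GenNull.pair _
    change GenNull ε S (ψ a) (ψ b) (ψ c)
    by_cases hc : c = 0
    · subst hc; exact hz _ _ h
    by_cases hb : b = 0
    · subst hb
      exact (hz _ _ (P.null_rotate _ _ _ (P.null_rotate _ _ _ h))).rotate
    by_cases ha : a = 0
    · subst ha
      exact (hz _ _ (P.null_rotate _ _ _ h)).rotate.rotate
    have := GenNull.triple (ε := ε) 1 _ _ _
      (h2 (Units.mk0 a ha) (Units.mk0 b hb) (Units.mk0 c hc) h)
    rw [one_mul, one_mul, one_mul, ← hu, ← hu, ← hu] at this
    exact this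

theorem generateLift_apply {P : Pasture.{u}} (φ : P.carrierˣ →* G) (h1 : φ P.negOne = ε)
    (h2 : ∀ a b c : P.carrierˣ, P.null a b c → S (φ a) (φ b) (φ c)) (x : P.carrierˣ) :
    (generateLift (hε := hε) φ h1 h2).toMap (x : P.carrier) = (φ x : WithZero G) :=
  extendUnits_apply φ x

theorem generateDesc_apply {Q : Pasture.{u}} (φ : G →* Q.carrier) (h1 : φ ε = Q.neg 1)
    (h2 : ∀ a b c, S a b c → Q.null (φ a) (φ b) (φ c)) (x : G) :
    (generateDesc (hε := hε) φ h1 h2).toMap (x : WithZero G) = φ x := rfl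

theorem generate_hom_ext {Q : Pasture.{u}} {f g : generate ε hε S ⟶ Q}
    (h : ∀ x : G, f.toMap (x : WithZero G) = g.toMap (x : WithZero G)) : f = g := by
  apply hom_ext
  intro a
  change WithZero G at a
  induction a with
  | zero => exact (map_zero f.toMap).trans (map_zero g.toMap).symm
  | coe x => exact h x

end Generate

end Pasture

/-! ### Abelian groups by generators and relations -/

/-- The abelian group with generators `X` and relations `r = 1` for `r ∈ rels`. -/
abbrev AbGroupPresentation (X : Type u) (rels : Set (FreeGroup X)) : Type u :=
  Abelianization (PresentedGroup rels)

namespace AbGroupPresentation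

variable {X : Type u} {rels : Set (FreeGroup X)} {A : Type v} [CommGroup A]

/-- The projection from the free group. -/
def mk (rels : Set (FreeGroup X)) : FreeGroup X →* AbGroupPresentation X rels :=
  Abelianization.of.comp (PresentedGroup.mk rels)

/-- The generators. -/
def of (rels : Set (FreeGroup X)) (x : X) : AbGroupPresentation X rels := mk rels (FreeGroup.of x)

theorem mk_rel {r : FreeGroup X} (hr : r ∈ rels) : mk rels r = 1 := by
  have : PresentedGroup.mk rels r = 1 := PresentedGroup.one_of_mem hr
  simp [mk, this]

theorem mk_of (x : X) : mk rels (FreeGroup.of x) = of rels x := rfl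

/-- The universal property of the presentation. -/
def lift (f : X → A) (h : ∀ r ∈ rels, FreeGroup.lift f r = 1) : AbGroupPresentation X rels →* A :=
  Abelianization.lift (PresentedGroup.toGroup h)

theorem lift_of (f : X → A) (h : ∀ r ∈ rels, FreeGroup.lift f r = 1) (x : X) :
    lift f h (of rels x) = f x := by
  change Abelianization.lift (PresentedGroup.toGroup h) (Abelianization.of (PresentedGroup.of x)) = _
  rw [Abelianization.lift_apply_of, PresentedGroup.toGroup.of]

theorem hom_ext {f g : AbGroupPresentation X rels →* A} (h : ∀ x, f (of rels x) = g (of rels x)) :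
    f = g :=
  Abelianization.hom_ext _ _ (PresentedGroup.ext h)

theorem hom_ext_monoid {B : Type v} [CommMonoid B] {f g : AbGroupPresentation X rels →* B}
    (h : ∀ x, f (of rels x) = g (of rels x)) : f = g := by
  have : f.toHomUnits = g.toHomUnits := hom_ext fun x => Units.ext (h x)
  refine MonoidHom.ext fun x => ?_
  exact congrArg Units.val (DFunLike.congr_fun this x)

end AbGroupPresentation

/-! ### Colimits of pastures -/

namespace Pasture

section Colimit

variable {J : Type u} [Category.{u} J] (F : J ⥤ Pasture.{u})

/-- Generators of the unit group of the colimit: an element `-1` and all units of all pastures in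
the diagram. -/
abbrev ColimGen : Type u := Option (Σ j : J, (F.obj j).carrierˣ)

/-- Relations for the unit group of the colimit. -/
inductive ColimRel : Set (FreeGroup (ColimGen F))
  | neg_sq : ColimRel (FreeGroup.of none * FreeGroup.of none)
  | neg (j : J) :
      ColimRel (FreeGroup.of (some ⟨j, (F.obj j).negOne⟩) * (FreeGroup.of none)⁻¹)
  | mul (j : J) (a b : (F.obj j).carrierˣ) :
      ColimRel (FreeGroup.of (some ⟨j, a * b⟩) *
        (FreeGroup.of (some ⟨j, a⟩) * FreeGroup.of (some ⟨j, b⟩))⁻¹)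
  | map (i j : J) (f : i ⟶ j) (a : (F.obj i).carrierˣ) :
      ColimRel (FreeGroup.of (some ⟨i, a⟩) *
        (FreeGroup.of (some ⟨j, Units.map (F.map f).toMap.toMonoidHom a⟩))⁻¹)

/-- The unit group of the colimit. -/
abbrev ColimGroup : Type u := AbGroupPresentation (ColimGen F) (ColimRel F)

/-- The element `-1` of the colimit. -/
def colimNeg : ColimGroup F := AbGroupPresentation.of _ none

theorem colimNeg_sq : colimNeg F * colimNeg F = 1 := by
  have := AbGroupPresentation.mk_rel (ColimRel.neg_sq (F := F))
  rwa [map_mul, AbGroupPresentation.mk_of] at this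

/-- The canonical homomorphisms from the unit groups of the pastures in the diagram. -/
def colimUnits (j : J) : (F.obj j).carrierˣ →* ColimGroup F :=
  MonoidHom.mk' (fun a => AbGroupPresentation.of _ (some ⟨j, a⟩)) (fun a b => by
    have := AbGroupPresentation.mk_rel (ColimRel.mul (F := F) j a b)
    rwa [map_mul, map_inv, map_mul, AbGroupPresentation.mk_of, AbGroupPresentation.mk_of,
      AbGroupPresentation.mk_of, mul_inv_eq_one] at this)

/-- The generators of the null set of the colimit. -/
inductive ColimNull : ColimGroup F → ColimGroup F → ColimGroup F → Prop
  | mk (j : J) (a b c : (F.obj j).carrierˣ) (h : (F.obj j).null a b c) :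
      ColimNull (colimUnits F j a) (colimUnits F j b) (colimUnits F j c)

theorem colimUnits_negOne (j : J) : colimUnits F j (F.obj j).negOne = colimNeg F := by
  have := AbGroupPresentation.mk_rel (ColimRel.neg (F := F) j)
  rwa [map_mul, map_inv, AbGroupPresentation.mk_of, AbGroupPresentation.mk_of,
    mul_inv_eq_one] at this

/-- The underlying pasture of the colimit. -/
def colimPasture : Pasture.{u} := generate (colimNeg F) (colimNeg_sq F) (ColimNull F)

/-- The canonical morphisms into the colimit. -/
def colimMap (j : J) : F.obj j ⟶ colimPasture F :=
  generateLift (colimUnits F j) (colimUnits_negOne F j) (ColimNull.mk j)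

theorem colimMap_apply (j : J) (x : (F.obj j).carrierˣ) :
    (colimMap F j).toMap (x : (F.obj j).carrier) =
      (colimUnits F j x : WithZero (ColimGroup F)) :=
  generateLift_apply _ _ _ x

/-- Two morphisms that agree on units are equal. -/
theorem hom_ext_units {P Q : Pasture.{u}} {f g : P ⟶ Q}
    (h : ∀ a : P.carrierˣ, f.toMap (a : P.carrier) = g.toMap (a : P.carrier)) : f = g := by
  apply hom_ext
  intro a
  by_cases ha : a = 0
  · subst ha
    rw [map_zero, map_zero]
  · exact h (Units.mk0 a ha)

theorem colimMap_comp {i j : J} (f : i ⟶ j) : F.map f ≫ colimMap F j = colimMap F i := by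
  apply hom_ext_units
  intro a
  have h1 : (F.map f).toMap (a : (F.obj i).carrier) =
      ((Units.map (F.map f).toMap.toMonoidHom a : (F.obj j).carrierˣ) : (F.obj j).carrier) := rfl
  rw [comp_apply, h1, colimMap_apply, colimMap_apply]
  have := AbGroupPresentation.mk_rel (ColimRel.map (F := F) i j f a)
  rw [map_mul, map_inv, AbGroupPresentation.mk_of, AbGroupPresentation.mk_of,
    mul_inv_eq_one] at this
  exact congrArg _ this.symm

/-- An explicit colimit cocone. -/
def colimCocone : Cocone F where
  pt := colimPasture F
  ι :=
    { app := colimMap F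
      naturality := fun _ _ f => (colimMap_comp F f).trans (Category.comp_id _).symm }

/-- The group homomorphism underlying the universal morphism to another cocone. -/
def colimDescUnits (s : Cocone F) : ColimGroup F →* s.pt.carrierˣ :=
  AbGroupPresentation.lift
    (fun x => x.elim s.pt.negOne
      (fun p => Units.map (s.ι.app p.1).toMap.toMonoidHom p.2)) (by
    intro r hr
    cases hr with
    | neg_sq =>
      simp only [map_mul, FreeGroup.lift_apply_of, Option.elim]
      exact Units.ext s.pt.neg_one_sq
    | neg j =>
      simp only [map_mul, map_inv, FreeGroup.lift_apply_of, Option.elim, mul_inv_eq_one]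
      refine Units.ext (((s.ι.app j).map_neg 1).trans ?_)
      rw [map_one]; rfl
    | mul j a b =>
      simp only [map_mul, map_inv, FreeGroup.lift_apply_of, Option.elim, mul_inv_eq_one]
    | map i j f a =>
      simp only [map_mul, map_inv, FreeGroup.lift_apply_of, Option.elim, mul_inv_eq_one]
      refine Units.ext ?_
      have := congrArg (fun g => g.toMap (a : (F.obj i).carrier)) (s.w f)
      exact this.symm)

theorem colimDescUnits_apply (s : Cocone F) (j : J) (a : (F.obj j).carrierˣ) :
    (colimDescUnits F s (colimUnits F j a) : s.pt.carrier) =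
      (s.ι.app j).toMap (a : (F.obj j).carrier) := by
  have h : colimDescUnits F s (colimUnits F j a) =
      Units.map (s.ι.app j).toMap.toMonoidHom a :=
    AbGroupPresentation.lift_of _ _ (some ⟨j, a⟩ : ColimGen F)
  rw [h]
  rfl

theorem colimDescUnits_neg (s : Cocone F) :
    (colimDescUnits F s (colimNeg F) : s.pt.carrier) = s.pt.neg 1 :=
  congrArg Units.val (AbGroupPresentation.lift_of _ _ none)

/-- The universal morphism to another cocone. -/
def colimDesc (s : Cocone F) : colimPasture F ⟶ s.pt :=
  generateDesc ((Units.coeHom s.pt.carrier).comp (colimDescUnits F s))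
    (colimDescUnits_neg F s) (by
      intro x y z hxyz
      obtain ⟨j, a, b, c, h⟩ := hxyz
      have := (s.ι.app j).map_null _ _ _ h
      rw [← colimDescUnits_apply, ← colimDescUnits_apply, ← colimDescUnits_apply] at this
      exact this)

theorem colimDesc_apply (s : Cocone F) (x : ColimGroup F) :
    (colimDesc F s).toMap (x : WithZero (ColimGroup F)) = (colimDescUnits F s x : s.pt.carrier) :=
  rfl

/-- The explicit cocone is a colimit cocone. -/
def colimCoconeIsColimit : IsColimit (colimCocone F) where
  desc s := colimDesc F s
  fac s j := by
    apply hom_ext_units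
    intro a
    change (colimDesc F s).toMap ((colimMap F j).toMap (a : (F.obj j).carrier)) = _
    rw [colimMap_apply, colimDesc_apply]
    exact colimDescUnits_apply F s j a
  uniq s m hm := by
    change colimPasture F ⟶ s.pt at m
    apply generate_hom_ext
    intro x
    refine Eq.trans ?_ (colimDesc_apply F s x).symm
    let μ : ColimGroup F →* s.pt.carrier :=
      m.toMap.toMonoidHom.comp (WithZero.coeMonoidHom (α := ColimGroup F))
    change μ x = ((Units.coeHom s.pt.carrier).comp (colimDescUnits F s)) x
    suffices h : μ = (Units.coeHom s.pt.carrier).comp (colimDescUnits F s) by rw [h]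
    apply AbGroupPresentation.hom_ext_monoid
    intro y
    cases y with
    | none =>
      refine Eq.trans ?_ (colimDescUnits_neg F s).symm
      have h2 := Hom.map_neg m (1 : WithZero (ColimGroup F))
      have h3 : m.toMap (1 : WithZero (ColimGroup F)) = 1 := map_one m.toMap
      rw [h3] at h2
      rw [← h2]
      change m.toMap _ = m.toMap ((colimNeg F : WithZero (ColimGroup F)) *
        (1 : WithZero (ColimGroup F)))
      rw [mul_one]; rfl
    | some p =>
      obtain ⟨j, a⟩ := p
      refine Eq.trans ?_ (colimDescUnits_apply F s j a).symm
      rw [← hm j]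
      change _ = m.toMap ((colimMap F j).toMap (a : (F.obj j).carrier))
      rw [colimMap_apply]
      rfl

end Colimit

instance : HasColimits Pasture.{u} where
  has_colimits_of_shape _ _ :=
    { has_colimit := fun F => ⟨⟨⟨colimCocone F, colimCoconeIsColimit F⟩⟩⟩ }

end Pasture

/-! ### The Tutte group and the foundation of a matroid -/

namespace Matroid

variable {α : Type u} {β : Type u} {γ : Type u}

/-- `l` is an ordered basis of `M`: its entries are distinct and form a basis. -/
def IsBaseList (M : Matroid α) (l : List M.E) : Prop :=
  l.Nodup ∧ M.IsBase (Subtype.val '' {x | x ∈ l})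

/-- Generators of the extended Tutte group: `none` is the element `-1` and `some l` is the symbol
`T_l` of the ordered basis `l`. -/
abbrev TutteGen (M : Matroid α) : Type u := Option {l : List M.E // M.IsBaseList l}

/-- Relations of the extended Tutte group: `(-1)² = 1`; the symbols `T_l` are alternating (it is
enough to exchange two adjacent entries); and `T_{Iac} T_{Ibd} = T_{Iad} T_{Ibc}` whenever these
four tuples are bases but one of `Iab`, `Icd` is not. -/
inductive TutteRel (M : Matroid α) : Set (FreeGroup M.TutteGen)
  | neg_sq : TutteRel M (FreeGroup.of none * FreeGroup.of none)
  | swap (p s : List M.E) (a b : M.E)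
      (h : M.IsBaseList (p ++ a :: b :: s)) (h' : M.IsBaseList (p ++ b :: a :: s)) :
      TutteRel M (FreeGroup.of (some ⟨_, h⟩) *
        (FreeGroup.of none * FreeGroup.of (some ⟨_, h'⟩))⁻¹)
  | degenerate (I : List M.E) (a b c d : M.E)
      (hac : M.IsBaseList (I ++ [a, c])) (hbd : M.IsBaseList (I ++ [b, d]))
      (had : M.IsBaseList (I ++ [a, d])) (hbc : M.IsBaseList (I ++ [b, c]))
      (hdeg : ¬ M.IsBaseList (I ++ [a, b]) ∨ ¬ M.IsBaseList (I ++ [c, d])) :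
      TutteRel M (FreeGroup.of (some ⟨_, hac⟩) * FreeGroup.of (some ⟨_, hbd⟩) *
        (FreeGroup.of (some ⟨_, had⟩) * FreeGroup.of (some ⟨_, hbc⟩))⁻¹)

/-- The extended Tutte group, generated by `-1` and the symbols `T_l`. -/
abbrev ExtTutteGroup (M : Matroid α) : Type u := AbGroupPresentation M.TutteGen M.TutteRel

/-- The element `-1`. -/
def tutteNeg (M : Matroid α) : M.ExtTutteGroup := AbGroupPresentation.of _ none

open Classical in
/-- The symbol `T_l` of an ordered basis `l` (and `1` if `l` is not an ordered basis). -/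
def tutteSymbol (M : Matroid α) (l : List M.E) : M.ExtTutteGroup :=
  if h : M.IsBaseList l then AbGroupPresentation.of _ (some ⟨l, h⟩) else 1

/-- The Tutte group, generated by `-1` and the quotients `T_l / T_{l'}`. -/
def tutteGroup (M : Matroid α) : Subgroup M.ExtTutteGroup :=
  Subgroup.closure ({M.tutteNeg} ∪
    {x | ∃ l l', M.IsBaseList l ∧ M.IsBaseList l' ∧ x = M.tutteSymbol l / M.tutteSymbol l'})

/-- The sum in `ℤ^E` of the basis vectors of the entries of a list. -/
def listDegree (M : Matroid α) (l : List M.E) : M.E →₀ ℤ :=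
  (l.map fun e => Finsupp.single e (1 : ℤ)).sum

/-- The multidegree: `-1` has degree `0` and `T_l` has degree the sum of its entries. -/
def multidegree (M : Matroid α) : M.ExtTutteGroup →* Multiplicative (M.E →₀ ℤ) :=
  AbGroupPresentation.lift
    (fun x => x.elim 1 fun l => Multiplicative.ofAdd (M.listDegree l.1)) (by
    intro r hr
    cases hr with
    | neg_sq => simp
    | swap p s a b h h' =>
      simp only [map_mul, map_inv, FreeGroup.lift_apply_of, Option.elim, mul_inv_eq_one, one_mul]
      congr 1
      simp only [listDegree, List.map_append, List.map_cons, List.sum_append, List.sum_cons]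
      abel
    | degenerate I a b c d hac hbd had hbc hdeg =>
      simp only [map_mul, map_inv, FreeGroup.lift_apply_of, Option.elim, mul_inv_eq_one,
        ← ofAdd_add]
      congr 1
      simp only [listDegree, List.map_append, List.map_cons, List.sum_append, List.sum_cons]
      abel)

/-- The inner Tutte group: the elements of multidegree zero of the Tutte group. -/
def innerTutteGroup (M : Matroid α) : Subgroup M.ExtTutteGroup :=
  M.tutteGroup ⊓ M.multidegree.ker

theorem tutteNeg_sq (M : Matroid α) : M.tutteNeg * M.tutteNeg = 1 := by
  have := AbGroupPresentation.mk_rel (TutteRel.neg_sq (M := M))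
  rwa [map_mul, AbGroupPresentation.mk_of] at this

theorem tutteSymbol_of {M : Matroid α} {l : List M.E} (h : M.IsBaseList l) :
    M.tutteSymbol l = AbGroupPresentation.of _ (some ⟨l, h⟩) := dif_pos h

theorem multidegree_tutteNeg (M : Matroid α) : M.multidegree M.tutteNeg = 1 :=
  AbGroupPresentation.lift_of _ _ _

theorem multidegree_tutteSymbol {M : Matroid α} {l : List M.E} (h : M.IsBaseList l) :
    M.multidegree (M.tutteSymbol l) = Multiplicative.ofAdd (M.listDegree l) := by
  rw [tutteSymbol_of h]
  exact AbGroupPresentation.lift_of _ _ _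

theorem tutteNeg_mem (M : Matroid α) : M.tutteNeg ∈ M.innerTutteGroup :=
  ⟨Subgroup.subset_closure (Or.inl rfl), M.multidegree_tutteNeg⟩

/-- `Iac`, `Iad`, `Ibc` and `Ibd` are bases. -/
structure IsCrossTuple (M : Matroid α) (I : List M.E) (a b c d : M.E) : Prop where
  ac : M.IsBaseList (I ++ [a, c])
  ad : M.IsBaseList (I ++ [a, d])
  bc : M.IsBaseList (I ++ [b, c])
  bd : M.IsBaseList (I ++ [b, d])

/-- Nondegenerate tuples: `Iab` and `Icd` are bases as well. -/
structure IsNondegenerateCrossTuple (M : Matroid α) (I : List M.E) (a b c d : M.E) : Prop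
    extends M.IsCrossTuple I a b c d where
  ab : M.IsBaseList (I ++ [a, b])
  cd : M.IsBaseList (I ++ [c, d])

/-- The universal cross ratio `T_{Iac} T_{Ibd} / (T_{Iad} T_{Ibc})` in the extended Tutte group. -/
def extCrossRatio (M : Matroid α) (I : List M.E) (a b c d : M.E) : M.ExtTutteGroup :=
  (M.tutteSymbol (I ++ [a, c]) * M.tutteSymbol (I ++ [b, d])) /
    (M.tutteSymbol (I ++ [a, d]) * M.tutteSymbol (I ++ [b, c]))

theorem IsCrossTuple.mem {M : Matroid α} {I : List M.E} {a b c d : M.E}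
    (h : M.IsCrossTuple I a b c d) : M.extCrossRatio I a b c d ∈ M.innerTutteGroup := by
  constructor
  · rw [extCrossRatio, mul_div_mul_comm]
    exact mul_mem (Subgroup.subset_closure (Or.inr ⟨_, _, h.ac, h.ad, rfl⟩))
      (Subgroup.subset_closure (Or.inr ⟨_, _, h.bd, h.bc, rfl⟩))
  · change M.multidegree _ = 1
    rw [extCrossRatio, map_div, map_mul, map_mul, multidegree_tutteSymbol h.ac,
      multidegree_tutteSymbol h.ad, multidegree_tutteSymbol h.bc, multidegree_tutteSymbol h.bd,
      div_eq_one, ← ofAdd_add, ← ofAdd_add]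
    congr 1
    simp only [listDegree, List.map_append, List.map_cons, List.sum_append, List.sum_cons]
    abel

/-- The universal cross ratio as an element of the inner Tutte group. -/
def crossRatio (M : Matroid α) (I : List M.E) (a b c d : M.E) (h : M.IsCrossTuple I a b c d) :
    M.innerTutteGroup :=
  ⟨M.extCrossRatio I a b c d, h.mem⟩

theorem IsBaseList.perm {M : Matroid α} {l l' : List M.E} (h : M.IsBaseList l) (hp : l.Perm l') :
    M.IsBaseList l' := by
  refine ⟨hp.nodup_iff.1 h.1, ?_⟩
  have : {x | x ∈ l'} = {x | x ∈ l} := Set.ext fun x => hp.mem_iff.symm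
  rw [this]
  exact h.2

theorem IsNondegenerateCrossTuple.exchange {M : Matroid α} {I : List M.E} {a b c d : M.E}
    (h : M.IsNondegenerateCrossTuple I a b c d) : M.IsNondegenerateCrossTuple I a c b d where
  ac := h.ab
  ad := h.ad
  bc := h.bc.perm ((List.Perm.swap _ _ _).append_left I)
  bd := h.cd
  ab := h.ac
  cd := h.bd

/-- The element `-1` of the inner Tutte group. -/
def innerNeg (M : Matroid α) : M.innerTutteGroup := ⟨M.tutteNeg, M.tutteNeg_mem⟩

/-- The additive relations `[a b; c d]_I + [a c; b d]_I - 1` of the foundation. -/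
inductive FoundationNull (M : Matroid α) :
    M.innerTutteGroup → M.innerTutteGroup → M.innerTutteGroup → Prop
  | plucker (I : List M.E) (a b c d : M.E) (h : M.IsNondegenerateCrossTuple I a b c d) :
      FoundationNull M (M.crossRatio I a b c d h.toIsCrossTuple)
        (M.crossRatio I a c b d h.exchange.toIsCrossTuple) M.innerNeg

/-- The foundation of `M`: the pasture whose unit group is the inner Tutte group and whose null
set is generated by the relations `[a b; c d]_I + [a c; b d]_I - 1`. -/
def foundation (M : Matroid α) : Pasture.{u} :=
  Pasture.generate M.innerNeg (Subtype.ext M.tutteNeg_sq) M.FoundationNull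

/-! ### Minor embeddings and induced morphisms of foundations -/

/-- A minor embedding of `N` into `M`: an injection `toFun` of ground sets and a set `con` to be
contracted, such that `N` is identified with the minor of `M` on the image of `toFun` that is
obtained by contracting `con` and deleting the rest.  Testing this on bases (rather than merely on
independent sets) means precisely that `con` is independent and that the deleted set is
coindependent. -/
structure MinorEmbedding (N : Matroid α) (M : Matroid β) where
  toFun : N.E → M.E
  injective : Function.Injective toFun
  con : Finset M.E
  notMem_con : ∀ x, toFun x ∉ con
  isBase_iff : ∀ B : Set N.E,
    N.IsBase (Subtype.val '' B) ↔ M.IsBase (Subtype.val '' (toFun '' B ∪ con))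

namespace MinorEmbedding

variable {N : Matroid α} {M : Matroid β} {L : Matroid γ}

/-- `j` is an ordering of the contracted set. -/
def IsOrdering (e : N.MinorEmbedding M) (j : List M.E) : Prop :=
  j.Nodup ∧ ∀ x, x ∈ j ↔ x ∈ e.con

theorem isOrdering_toList (e : N.MinorEmbedding M) : e.IsOrdering e.con.toList :=
  ⟨e.con.nodup_toList, fun _ => Finset.mem_toList⟩

theorem isBaseList_iff (e : N.MinorEmbedding M) {j : List M.E} (hj : e.IsOrdering j)
    (l : List N.E) : N.IsBaseList l ↔ M.IsBaseList (j ++ l.map e.toFun) := by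
  have h1 : {x | x ∈ j ++ l.map e.toFun} = e.toFun '' {x | x ∈ l} ∪ e.con := by
    ext x
    simp only [List.mem_append, hj.2, List.mem_map, Set.mem_ofPred_eq, Set.mem_union,
      Set.mem_image, Finset.mem_coe]
    exact or_comm
  have h2 : (j ++ l.map e.toFun).Nodup ↔ l.Nodup := by
    rw [List.nodup_append', List.nodup_map_iff e.injective]
    refine ⟨fun h => h.2.1, fun h => ⟨hj.1, h, ?_⟩⟩
    intro x hx hx'
    obtain ⟨y, _, rfl⟩ := List.mem_map.1 hx'
    exact e.notMem_con y ((hj.2 _).1 hx)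
  rw [IsBaseList, IsBaseList, h1, h2, e.isBase_iff]

/-- The homomorphism `T_l ↦ T_{j ++ l}` of extended Tutte groups. -/
def extMap (e : N.MinorEmbedding M) {j : List M.E} (hj : e.IsOrdering j) :
    N.ExtTutteGroup →* M.ExtTutteGroup :=
  AbGroupPresentation.lift
    (fun x => x.elim M.tutteNeg fun l => M.tutteSymbol (j ++ l.1.map e.toFun)) (by
    intro r hr
    cases hr with
    | neg_sq =>
      simp only [map_mul, FreeGroup.lift_apply_of, Option.elim]
      exact M.tutteNeg_sq
    | swap p s a b h h' =>
      simp only [map_mul, map_inv, FreeGroup.lift_apply_of, Option.elim, mul_inv_eq_one]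
      have k := (e.isBaseList_iff hj _).1 h
      have k' := (e.isBaseList_iff hj _).1 h'
      simp only [List.map_append, List.map_cons, ← List.append_assoc] at k k' ⊢
      have := AbGroupPresentation.mk_rel (TutteRel.swap _ _ _ _ k k')
      rw [map_mul, map_inv, map_mul, AbGroupPresentation.mk_of, AbGroupPresentation.mk_of,
        AbGroupPresentation.mk_of, mul_inv_eq_one] at this
      rw [tutteSymbol_of k, tutteSymbol_of k']
      exact this
    | degenerate I a b c d hac hbd had hbc hdeg =>
      simp only [map_mul, map_inv, FreeGroup.lift_apply_of, Option.elim, mul_inv_eq_one]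
      have kac := (e.isBaseList_iff hj _).1 hac
      have kbd := (e.isBaseList_iff hj _).1 hbd
      have kad := (e.isBaseList_iff hj _).1 had
      have kbc := (e.isBaseList_iff hj _).1 hbc
      rw [e.isBaseList_iff hj, e.isBaseList_iff hj] at hdeg
      simp only [List.map_append, List.map_cons, List.map_nil, ← List.append_assoc]
        at kac kbd kad kbc hdeg ⊢
      have := AbGroupPresentation.mk_rel (TutteRel.degenerate _ _ _ _ _ kac kbd kad kbc hdeg)
      rw [map_mul, map_inv, map_mul, map_mul, AbGroupPresentation.mk_of, AbGroupPresentation.mk_of,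
        AbGroupPresentation.mk_of, AbGroupPresentation.mk_of, mul_inv_eq_one] at this
      rw [tutteSymbol_of kac, tutteSymbol_of kbd, tutteSymbol_of kad, tutteSymbol_of kbc]
      exact this)

theorem extMap_tutteNeg (e : N.MinorEmbedding M) {j : List M.E} (hj : e.IsOrdering j) :
    e.extMap hj N.tutteNeg = M.tutteNeg :=
  AbGroupPresentation.lift_of _ _ _

theorem extMap_tutteSymbol (e : N.MinorEmbedding M) {j : List M.E} (hj : e.IsOrdering j)
    (l : List N.E) : e.extMap hj (N.tutteSymbol l) = M.tutteSymbol (j ++ l.map e.toFun) := by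
  by_cases h : N.IsBaseList l
  · rw [tutteSymbol_of h]
    exact AbGroupPresentation.lift_of _ _ _
  · have h' : ¬ M.IsBaseList (j ++ l.map e.toFun) := fun k => h ((e.isBaseList_iff hj l).2 k)
    rw [tutteSymbol, tutteSymbol, dif_neg h, dif_neg h', map_one]

/-- Homomorphisms that agree on `-1` and on all `T_l / T_{l'}` agree on the Tutte group. -/
theorem _root_.Matroid.eqOn_tutteGroup {A : Type v} [CommGroup A] {f g : N.ExtTutteGroup →* A}
    (h1 : f N.tutteNeg = g N.tutteNeg)
    (h2 : ∀ l l', N.IsBaseList l → N.IsBaseList l' →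
      f (N.tutteSymbol l) / f (N.tutteSymbol l') = g (N.tutteSymbol l) / g (N.tutteSymbol l'))
    {x : N.ExtTutteGroup} (hx : x ∈ N.tutteGroup) : f x = g x := by
  refine MonoidHom.eqOn_closure (f := f) (g := g) ?_ hx
  rintro y (rfl | ⟨l, l', hl, hl', rfl⟩)
  · exact h1
  · rw [map_div, map_div, h2 l l' hl hl']

/-- The homomorphism `ℤ^{E(N)} → ℤ^{E(M)}` induced by a minor embedding. -/
def pushforward (e : N.MinorEmbedding M) : (N.E →₀ ℤ) →+ (M.E →₀ ℤ) :=
  Finsupp.mapDomain.addMonoidHom e.toFun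

theorem extMap_mem (e : N.MinorEmbedding M) {j : List M.E} (hj : e.IsOrdering j)
    {x : N.ExtTutteGroup} (hx : x ∈ N.innerTutteGroup) : e.extMap hj x ∈ M.innerTutteGroup := by
  constructor
  · have : N.tutteGroup ≤ M.tutteGroup.comap (e.extMap hj) := by
      refine (Subgroup.closure_le _).2 ?_
      rintro y (rfl | ⟨l, l', hl, hl', rfl⟩)
      · change e.extMap hj N.tutteNeg ∈ M.tutteGroup
        rw [extMap_tutteNeg]
        exact Subgroup.subset_closure (Or.inl rfl)
      · change e.extMap hj _ ∈ M.tutteGroup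
        rw [map_div, extMap_tutteSymbol, extMap_tutteSymbol]
        exact Subgroup.subset_closure (Or.inr
          ⟨_, _, (e.isBaseList_iff hj _).1 hl, (e.isBaseList_iff hj _).1 hl', rfl⟩)
    exact this hx.1
  · have key : M.multidegree (e.extMap hj x) =
        (AddMonoidHom.toMultiplicative e.pushforward)
          (N.multidegree x) := by
      refine eqOn_tutteGroup (f := M.multidegree.comp (e.extMap hj))
        (g := (AddMonoidHom.toMultiplicative e.pushforward).comp
          N.multidegree) ?_ ?_ hx.1
      · rw [MonoidHom.comp_apply, MonoidHom.comp_apply, extMap_tutteNeg, multidegree_tutteNeg,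
          multidegree_tutteNeg, map_one]
      · intro l l' hl hl'
        have hd : ∀ l, M.listDegree (j ++ l.map e.toFun) =
            M.listDegree j + e.pushforward (N.listDegree l) := by
          intro l
          simp [listDegree, pushforward, map_list_sum, List.map_map, Function.comp_def,
            Finsupp.mapDomain_single]
        simp only [MonoidHom.comp_apply, extMap_tutteSymbol]
        rw [multidegree_tutteSymbol ((e.isBaseList_iff hj _).1 hl),
          multidegree_tutteSymbol ((e.isBaseList_iff hj _).1 hl'),
          multidegree_tutteSymbol hl, multidegree_tutteSymbol hl', hd, hd, ← ofAdd_sub,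
          add_sub_add_left_eq_sub, ← map_div, ← ofAdd_sub, AddMonoidHom.toMultiplicative_apply_apply,
          toAdd_ofAdd, map_sub e.pushforward]
    change M.multidegree _ = 1
    rw [key, show N.multidegree x = 1 from hx.2, map_one]

/-- The homomorphism of inner Tutte groups induced by a minor embedding. -/
def innerMap (e : N.MinorEmbedding M) {j : List M.E} (hj : e.IsOrdering j) :
    N.innerTutteGroup →* M.innerTutteGroup :=
  ((e.extMap hj).comp N.innerTutteGroup.subtype).codRestrict M.innerTutteGroup
    fun x => e.extMap_mem hj x.2

theorem innerMap_crossRatio (e : N.MinorEmbedding M) {j : List M.E} (hj : e.IsOrdering j)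
    {I : List N.E} {a b c d : N.E} (h : N.IsCrossTuple I a b c d)
    (h' : M.IsCrossTuple (j ++ I.map e.toFun) (e.toFun a) (e.toFun b) (e.toFun c) (e.toFun d)) :
    e.innerMap hj (N.crossRatio I a b c d h) = M.crossRatio _ _ _ _ _ h' := by
  refine Subtype.ext ?_
  change e.extMap hj (N.extCrossRatio I a b c d) = M.extCrossRatio _ _ _ _ _
  simp only [extCrossRatio, map_div, map_mul, extMap_tutteSymbol, List.map_append, List.map_cons,
    List.map_nil, List.append_assoc]

theorem nondegenerate (e : N.MinorEmbedding M) {j : List M.E} (hj : e.IsOrdering j)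
    {I : List N.E} {a b c d : N.E} (h : N.IsNondegenerateCrossTuple I a b c d) :
    M.IsNondegenerateCrossTuple (j ++ I.map e.toFun) (e.toFun a) (e.toFun b) (e.toFun c)
      (e.toFun d) := by
  have key : ∀ x y, N.IsBaseList (I ++ [x, y]) →
      M.IsBaseList (j ++ I.map e.toFun ++ [e.toFun x, e.toFun y]) := by
    intro x y hxy
    have := (e.isBaseList_iff hj _).1 hxy
    simpa only [List.map_append, List.map_cons, List.map_nil, List.append_assoc] using this
  exact { ac := key _ _ h.ac, ad := key _ _ h.ad, bc := key _ _ h.bc, bd := key _ _ h.bd,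
          ab := key _ _ h.ab, cd := key _ _ h.cd }

/-- The morphism of foundations induced by a minor embedding.  It maps the cross ratio
`[a b; c d]_I` of `N` to the cross ratio `[a b; c d]_{I ∪ con}` of `M`; it does not depend on the
chosen ordering of `con`. -/
def foundationMap (e : N.MinorEmbedding M) : N.foundation ⟶ M.foundation :=
  Pasture.generateDesc
    ((WithZero.coeMonoidHom (α := M.innerTutteGroup)).comp (e.innerMap e.isOrdering_toList))
    (by
      have h : e.innerMap e.isOrdering_toList N.innerNeg = M.innerNeg :=
        Subtype.ext (e.extMap_tutteNeg e.isOrdering_toList)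
      change ((e.innerMap e.isOrdering_toList N.innerNeg : M.innerTutteGroup) :
        WithZero M.innerTutteGroup) = (M.innerNeg : WithZero M.innerTutteGroup) *
          (1 : WithZero M.innerTutteGroup)
      rw [h, mul_one])
    (by
      intro x y z hxyz
      obtain ⟨I, a, b, c, d, h⟩ := hxyz
      have h' := e.nondegenerate e.isOrdering_toList h
      have h1 : e.innerMap e.isOrdering_toList N.innerNeg = M.innerNeg :=
        Subtype.ext (e.extMap_tutteNeg e.isOrdering_toList)
      have h2 := e.innerMap_crossRatio e.isOrdering_toList h.toIsCrossTuple h'.toIsCrossTuple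
      have h3 := e.innerMap_crossRatio e.isOrdering_toList h.exchange.toIsCrossTuple
        h'.exchange.toIsCrossTuple
      change Pasture.GenNull M.innerNeg M.FoundationNull
        ((e.innerMap e.isOrdering_toList _ : M.innerTutteGroup) : WithZero M.innerTutteGroup)
        ((e.innerMap e.isOrdering_toList _ : M.innerTutteGroup) : WithZero M.innerTutteGroup)
        ((e.innerMap e.isOrdering_toList _ : M.innerTutteGroup) : WithZero M.innerTutteGroup)
      rw [h1, h2, h3]
      have := Pasture.GenNull.triple (ε := M.innerNeg) (1 : WithZero M.innerTutteGroup) _ _ _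
        (FoundationNull.plucker _ _ _ _ _ h')
      rw [one_mul, one_mul, one_mul] at this
      exact this)

/-- Reordering a prefix multiplies all symbols by the same sign. -/
theorem _root_.Matroid.exists_sign (M : Matroid α) {j j' : List M.E} (h : j.Perm j') :
    ∃ s : M.ExtTutteGroup, ∀ p l, M.IsBaseList (p ++ (j ++ l)) →
      M.tutteSymbol (p ++ (j' ++ l)) = s * M.tutteSymbol (p ++ (j ++ l)) := by
  induction h with
  | nil => exact ⟨1, fun p l _ => (one_mul _).symm⟩
  | @cons x l₁ l₂ _ ih =>
    obtain ⟨s, hs⟩ := ih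
    refine ⟨s, fun p l h => ?_⟩
    have := hs (p ++ [x]) l (by simpa using h)
    simpa using this
  | swap x y t =>
    refine ⟨M.tutteNeg, fun p l h => ?_⟩
    have h' : M.IsBaseList (p ++ (x :: y :: t ++ l)) :=
      h.perm (((List.Perm.swap x y t).append_right l).append_left p)
    have := AbGroupPresentation.mk_rel (TutteRel.swap p (t ++ l) x y h' h)
    rw [map_mul, map_inv, map_mul, AbGroupPresentation.mk_of, AbGroupPresentation.mk_of,
      AbGroupPresentation.mk_of, mul_inv_eq_one] at this
    rw [tutteSymbol_of h', tutteSymbol_of h]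
    exact this
  | @trans l₁ l₂ l₃ h₁ h₂ ih₁ ih₂ =>
    obtain ⟨s, hs⟩ := ih₁
    obtain ⟨t, ht⟩ := ih₂
    refine ⟨t * s, fun p l h => ?_⟩
    rw [ht p l (h.perm ((h₁.append_right l).append_left p)), hs p l h, mul_assoc]

theorem extMap_eq (e : N.MinorEmbedding M) {j j' : List M.E} (hj : e.IsOrdering j)
    (hj' : e.IsOrdering j') {x : N.ExtTutteGroup} (hx : x ∈ N.tutteGroup) :
    e.extMap hj x = e.extMap hj' x := by
  have hp : j.Perm j' :=
    (List.perm_ext_iff_of_nodup hj.1 hj'.1).2 fun a => (hj.2 a).trans (hj'.2 a).symm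
  obtain ⟨s, hs⟩ := M.exists_sign hp
  have hs' : ∀ l, N.IsBaseList l → M.tutteSymbol (j' ++ l.map e.toFun) =
      s * M.tutteSymbol (j ++ l.map e.toFun) := fun l hl =>
    hs [] _ ((e.isBaseList_iff hj l).1 hl)
  refine eqOn_tutteGroup ?_ ?_ hx
  · rw [extMap_tutteNeg, extMap_tutteNeg]
  · intro l l' hl hl'
    simp only [extMap_tutteSymbol, hs' l hl, hs' l' hl', mul_div_mul_left_eq_div]

theorem foundationMap_apply (e : N.MinorEmbedding M) (x : N.innerTutteGroup) {j : List M.E}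
    (hj : e.IsOrdering j) :
    e.foundationMap.toMap (x : WithZero N.innerTutteGroup) =
      (e.innerMap hj x : WithZero M.innerTutteGroup) := by
  have : e.innerMap e.isOrdering_toList x = e.innerMap hj x :=
    Subtype.ext (e.extMap_eq e.isOrdering_toList hj x.2.1)
  rw [← this]
  rfl

/-- Functoriality of the foundation. -/
theorem foundationMap_comp (e₁ : N.MinorEmbedding M) (e₂ : M.MinorEmbedding L)
    (e₃ : N.MinorEmbedding L) (h : ∀ x, e₃.toFun x = e₂.toFun (e₁.toFun x))
    (hcon : ∀ y, y ∈ e₃.con ↔ y ∈ e₂.con ∨ ∃ x ∈ e₁.con, e₂.toFun x = y) :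
    e₁.foundationMap ≫ e₂.foundationMap = e₃.foundationMap := by
  have h1 := e₁.isOrdering_toList
  have h2 := e₂.isOrdering_toList
  have h3 : e₃.IsOrdering (e₂.con.toList ++ e₁.con.toList.map e₂.toFun) := by
    constructor
    · rw [List.nodup_append', List.nodup_map_iff e₂.injective]
      refine ⟨h2.1, h1.1, fun x hx hx' => ?_⟩
      obtain ⟨y, _, rfl⟩ := List.mem_map.1 hx'
      exact e₂.notMem_con y ((h2.2 _).1 hx)
    · intro y
      simp [hcon]
  apply Pasture.generate_hom_ext
  intro x
  have ha := e₁.foundationMap_apply x h1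
  have hb := e₂.foundationMap_apply (e₁.innerMap h1 x) h2
  have hc := e₃.foundationMap_apply x h3
  refine (congrArg e₂.foundationMap.toMap ha).trans (hb.trans (Eq.trans ?_ hc.symm))
  congr 1
  refine Subtype.ext ?_
  change e₂.extMap h2 (e₁.extMap h1 x) = e₃.extMap h3 x
  have : (e₂.extMap h2).comp (e₁.extMap h1) = e₃.extMap h3 := by
    apply AbGroupPresentation.hom_ext
    rintro (_ | ⟨l, hl⟩)
    · change e₂.extMap h2 (e₁.extMap h1 N.tutteNeg) = e₃.extMap h3 N.tutteNeg
      rw [extMap_tutteNeg, extMap_tutteNeg, extMap_tutteNeg]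
    · rw [← tutteSymbol_of hl, MonoidHom.comp_apply, extMap_tutteSymbol, extMap_tutteSymbol,
        extMap_tutteSymbol]
      congr 1
      simp [h]
  exact DFunLike.congr_fun this _

theorem foundationMap_id (e : N.MinorEmbedding N) (h : ∀ x, e.toFun x = x)
    (hcon : e.con = ∅) : e.foundationMap = 𝟙 _ := by
  have h1 : e.IsOrdering [] := ⟨List.nodup_nil, fun x => by simp [hcon]⟩
  apply Pasture.generate_hom_ext
  intro x
  refine (e.foundationMap_apply x h1).trans ?_
  have : e.innerMap h1 x = x := by
    refine Subtype.ext ?_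
    change e.extMap h1 x = x
    have : e.extMap h1 = MonoidHom.id _ := by
      apply AbGroupPresentation.hom_ext
      rintro (_ | ⟨l, hl⟩)
      · exact e.extMap_tutteNeg h1
      · rw [← tutteSymbol_of hl, extMap_tutteSymbol]
        have : e.toFun = id := funext h
        rw [this, List.map_id, List.nil_append]
        rfl
    rw [this]
    rfl
  rw [this]
  rfl

end MinorEmbedding

/-! ### Embedded minors -/

/-- An embedded minor `M ＼ del ／ con` of `M`, with a fixed choice of a coindependent set `del`
and an independent set `con`. -/
@[ext]
structure EmbeddedMinor (M : Matroid α) where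
  del : Set α
  con : Set α
  disjoint : Disjoint del con
  coindep : M.Coindep del
  indep : M.Indep con

namespace EmbeddedMinor

variable {M : Matroid α}

/-- The matroid underlying an embedded minor. -/
def toMatroid (N : M.EmbeddedMinor) : Matroid α := (M ＼ N.del) ／ N.con

/-- `N ≤ N'` if `N` is an embedded minor of `N'`. -/
instance : PartialOrder M.EmbeddedMinor where
  le N N' := N'.del ⊆ N.del ∧ N'.con ⊆ N.con
  le_refl _ := ⟨subset_rfl, subset_rfl⟩
  le_trans _ _ _ h h' := ⟨h'.1.trans h.1, h'.2.trans h.2⟩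
  le_antisymm _ _ h h' := EmbeddedMinor.ext (h'.1.antisymm h.1) (h'.2.antisymm h.2)

theorem ground_eq (N : M.EmbeddedMinor) : N.toMatroid.E = (M.E \ N.del) \ N.con := rfl

theorem mem_ground {N : M.EmbeddedMinor} {x : α} :
    x ∈ N.toMatroid.E ↔ x ∈ M.E ∧ x ∉ N.del ∧ x ∉ N.con := by
  rw [ground_eq]
  simp only [Set.mem_sdiff, and_assoc]

theorem isBase_iff (N : M.EmbeddedMinor) {B : Set α} (hB : B ⊆ N.toMatroid.E) :
    N.toMatroid.IsBase B ↔ M.IsBase (B ∪ N.con) := by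
  have hi : (M ＼ N.del).Indep N.con := by
    rw [Matroid.delete_indep_iff]
    exact ⟨N.indep, N.disjoint.symm⟩
  rw [toMatroid, hi.contract_isBase_iff, N.coindep.delete_isBase_iff]
  have h1 : Disjoint B N.con := Set.disjoint_left.2 fun x hx => (mem_ground.1 (hB hx)).2.2
  have h2 : Disjoint (B ∪ N.con) N.del :=
    Set.disjoint_union_left.2
      ⟨Set.disjoint_left.2 fun x hx => (mem_ground.1 (hB hx)).2.1, N.disjoint.symm⟩
  tauto

instance (N : M.EmbeddedMinor) [M.Finite] : N.toMatroid.Finite :=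
  ⟨M.ground_finite.subset fun _ hx => (mem_ground.1 hx).1⟩

theorem ground_mono {N N' : M.EmbeddedMinor} (h : N ≤ N') : N.toMatroid.E ⊆ N'.toMatroid.E := by
  intro x hx
  rw [mem_ground] at hx ⊢
  exact ⟨hx.1, fun h' => hx.2.1 (h.1 h'), fun h' => hx.2.2 (h.2 h')⟩

variable [M.Finite]

/-- The tautological minor embedding of an embedded minor into a larger one. -/
def incl {N N' : M.EmbeddedMinor} (h : N ≤ N') : N.toMatroid.MinorEmbedding N'.toMatroid where
  toFun := Set.inclusion (ground_mono h)
  injective := Set.inclusion_injective _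
  con :=
    haveI := N'.toMatroid.ground_finite.to_subtype
    (Set.toFinite {x : N'.toMatroid.E | (x : α) ∈ N.con}).toFinset
  notMem_con x hx := by
    rw [Set.Finite.mem_toFinset] at hx
    exact (mem_ground.1 x.2).2.2 hx
  isBase_iff B := by
    rw [N.isBase_iff (by rintro _ ⟨x, _, rfl⟩; exact x.2),
      N'.isBase_iff (by rintro _ ⟨x, _, rfl⟩; exact x.2)]
    have : (Subtype.val '' B ∪ N.con : Set α) =
        Subtype.val '' (Set.inclusion (ground_mono h) '' B ∪
          ((haveI := N'.toMatroid.ground_finite.to_subtype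
            (Set.toFinite {x : N'.toMatroid.E | (x : α) ∈ N.con}).toFinset :
              Finset N'.toMatroid.E) : Set N'.toMatroid.E)) ∪ N'.con := by
      rw [Set.Finite.coe_toFinset, Set.image_union, Set.image_image, Set.union_assoc]
      congr 1
      ext x
      simp only [Set.mem_union, Set.mem_image, Set.mem_ofPred_eq, Subtype.exists, exists_and_right,
        exists_eq_right]
      constructor
      · intro hx
        by_cases hx' : x ∈ N'.con
        · exact Or.inr hx'
        · refine Or.inl ⟨mem_ground.2 ⟨N.indep.subset_ground hx, fun hd => ?_, hx'⟩, hx⟩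
          exact Set.disjoint_left.1 N.disjoint (h.1 hd) hx
      · rintro (⟨_, hx⟩ | hx)
        · exact hx
        · exact h.2 hx
    rw [this]

/-- The tautological minor embedding of an embedded minor into `M`. -/
def toAmbient (N : M.EmbeddedMinor) : N.toMatroid.MinorEmbedding M where
  toFun := Set.inclusion fun _ hx => (mem_ground.1 hx).1
  injective := Set.inclusion_injective _
  con :=
    haveI := M.ground_finite.to_subtype
    (Set.toFinite {x : M.E | (x : α) ∈ N.con}).toFinset
  notMem_con x hx := by
    rw [Set.Finite.mem_toFinset] at hx
    exact (mem_ground.1 x.2).2.2 hx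
  isBase_iff B := by
    rw [N.isBase_iff (by rintro _ ⟨x, _, rfl⟩; exact x.2), Set.Finite.coe_toFinset,
      Set.image_union, Set.image_image]
    have : (Subtype.val '' {x : M.E | (x : α) ∈ N.con} : Set α) = N.con := by
      ext x
      simp only [Set.mem_image, Set.mem_ofPred_eq, Subtype.exists, exists_and_right,
        exists_eq_right]
      exact ⟨fun hx => hx.2, fun hx => ⟨N.indep.subset_ground hx, hx⟩⟩
    rw [this]

theorem mem_incl_con {N N' : M.EmbeddedMinor} (h : N ≤ N') (x : N'.toMatroid.E) :
    x ∈ (incl h).con ↔ (x : α) ∈ N.con :=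
  Set.Finite.mem_toFinset _

theorem mem_toAmbient_con {N : M.EmbeddedMinor} (x : M.E) :
    x ∈ N.toAmbient.con ↔ (x : α) ∈ N.con :=
  Set.Finite.mem_toFinset _

end EmbeddedMinor

variable (M : Matroid α) [M.Finite]

/-- The diagram of the foundations of all embedded minors of `M`, with the morphisms induced by
all minor embeddings between them. -/
def foundationDiagram : M.EmbeddedMinor ⥤ Pasture.{u} where
  obj N := N.toMatroid.foundation
  map f := (EmbeddedMinor.incl (leOfHom f)).foundationMap
  map_id N := MinorEmbedding.foundationMap_id _ (fun _ => rfl) (by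
    ext x
    rw [EmbeddedMinor.mem_incl_con]
    have := (EmbeddedMinor.mem_ground.1 x.2).2.2
    simp [this])
  map_comp {N₁ N₂ N₃} f g := by
    refine (MinorEmbedding.foundationMap_comp _ _ _ (fun _ => rfl) fun y => ?_).symm
    simp only [EmbeddedMinor.mem_incl_con]
    constructor
    · intro hy
      by_cases h2 : (y : α) ∈ N₂.con
      · exact Or.inl h2
      · refine Or.inr ⟨⟨y, EmbeddedMinor.mem_ground.2
          ⟨(EmbeddedMinor.mem_ground.1 y.2).1, fun hd => ?_, h2⟩⟩, hy, rfl⟩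
        exact Set.disjoint_left.1 N₁.disjoint ((leOfHom f).1 hd) hy
    · rintro (hy | ⟨x, hx, rfl⟩)
      · exact (leOfHom f).2 hy
      · exact hx

/-- The foundation of `M` as a cocone under the foundations of its embedded minors. -/
def foundationCocone : Cocone M.foundationDiagram where
  pt := M.foundation
  ι :=
    { app := fun N => N.toAmbient.foundationMap
      naturality := by
        intro N N' f
        refine (MinorEmbedding.foundationMap_comp _ _ _ (fun _ => rfl) fun y => ?_).trans
          (Category.comp_id _).symm
        simp only [EmbeddedMinor.mem_incl_con, EmbeddedMinor.mem_toAmbient_con]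
        constructor
        · intro hy
          by_cases h2 : (y : α) ∈ N'.con
          · exact Or.inl h2
          · refine Or.inr ⟨⟨y, EmbeddedMinor.mem_ground.2 ⟨y.2, fun hd => ?_, h2⟩⟩, hy, rfl⟩
            exact Set.disjoint_left.1 N.disjoint ((leOfHom f).1 hd) hy
        · rintro (hy | ⟨x, hx, rfl⟩)
          · exact (leOfHom f).2 hy
          · exact hx }

/-- The inclusion of the full subdiagram on a set of embedded minors. -/
def embeddedMinorInclusion (S : Set M.EmbeddedMinor) :
    {N : M.EmbeddedMinor // N ∈ S} ⥤ M.EmbeddedMinor :=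
  Monotone.functor (f := fun N : {N : M.EmbeddedMinor // N ∈ S} => N.1) fun _ _ h => h

/-- The canonical morphism from the colimit of the foundations of the embedded minors in `S`,
taken over all minor embeddings between them, to the foundation of `M`. -/
def canonicalMap (S : Set M.EmbeddedMinor) :
    colimit (M.embeddedMinorInclusion S ⋙ M.foundationDiagram) ⟶ M.foundation :=
  colimit.desc (M.embeddedMinorInclusion S ⋙ M.foundationDiagram)
    (M.foundationCocone.whisker (M.embeddedMinorInclusion S))

end Matroid

/-! ### Isomorphism types and fundamental types -/

/-- A finite matroid. -/
structure FiniteMatroid : Type (u + 1) where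
  {α : Type u}
  toMatroid : Matroid α
  [finite : toMatroid.Finite]

attribute [instance] FiniteMatroid.finite

/-- Isomorphism of matroids: a bijection of ground sets that identifies the independent sets. -/
def Matroid.Isomorphic {α β : Type u} (M : Matroid α) (N : Matroid β) : Prop :=
  ∃ e : M.E ≃ N.E, ∀ I : Set M.E, M.Indep (Subtype.val '' I) ↔ N.Indep (Subtype.val '' (e '' I))

instance FiniteMatroid.setoid : Setoid FiniteMatroid.{u} where
  r M N := M.toMatroid.Isomorphic N.toMatroid
  iseqv :=
    { refl := fun _ => ⟨Equiv.refl _, fun I => by simp⟩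
      symm := by
        rintro _ _ ⟨e, he⟩
        refine ⟨e.symm, fun I => ?_⟩
        rw [he, ← Set.image_comp e, Equiv.self_comp_symm, Set.image_id]
      trans := by
        rintro _ _ _ ⟨e, he⟩ ⟨f, hf⟩
        refine ⟨e.trans f, fun I => ?_⟩
        rw [he, hf, ← Set.image_comp f]
        rfl }

/-- Isomorphism types of finite matroids. -/
def MatroidType : Type (u + 1) := Quotient FiniteMatroid.setoid.{u}

namespace Matroid

variable {α : Type u}

/-- The isomorphism type of a finite matroid. -/
def isoType (M : Matroid α) [M.Finite] : MatroidType.{u} :=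
  Quotient.mk FiniteMatroid.setoid ⟨M⟩

/-- The embedded minors of `M` whose isomorphism type belongs to `D`. -/
def embeddedMinorsOfType (M : Matroid α) [M.Finite] (D : Set MatroidType.{u}) :
    Set M.EmbeddedMinor :=
  {N | N.toMatroid.isoType ∈ D}

/-- The proper embedded minors of `M` whose isomorphism type belongs to `C`. -/
def properEmbeddedMinorsOfType (M : Matroid α) [M.Finite] (C : Set MatroidType.{u}) :
    Set M.EmbeddedMinor :=
  {N | N.toMatroid ≠ M ∧ N.toMatroid.isoType ∈ C}

end Matroid

/-- The family `D` of isomorphism types presents the foundations of all matroids in `C`: for every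
matroid `M` in `C`, the canonical morphism from the colimit of the foundations of the embedded
minors of `M` with isomorphism type in `D` to the foundation of `M` is an isomorphism. -/
def Presents (D C : Set MatroidType.{u}) : Prop :=
  ∀ (α : Type u) (M : Matroid α) [M.Finite], M.isoType ∈ C →
    IsIso (M.canonicalMap (M.embeddedMinorsOfType D))

/-- A fundamental type of the class `C`: an inclusion-minimal family of isomorphism types of
matroids in `C` that presents the foundations of all matroids in `C`. -/
def IsFundamentalType (C D : Set MatroidType.{u}) : Prop :=
  Minimal (fun D' : Set MatroidType.{u} => D' ⊆ C ∧ Presents D' C) D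

end

/-!
The theorem splits into a statement about diagrams indexed by posets and a comparison of the
embedded minors of `M` with those of its minors.

Let `F` be a diagram on a well-founded poset `P`, and say that `S ⊆ P` presents `t` if `F t` is the
colimit of `F` over the elements of `S` below `t` (`IsColimitBelow`).  If `S ⊆ T` and `S` presents
all elements of `T`, then colimits over `S` and over `T` agree, so that `S` presents `t` if and only
if `T` does (`isColimitBelow_congr`).  For `C ⊆ P` let `irreducibles F C` be the set of all `t ∈ C`
that are not presented by `C \ {t}`.  By well-founded induction, `irreducibles F C` presents all
elements of `C`: an irreducible `t` presents itself, and for any other `t` it suffices to present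
the elements of `C` strictly below `t`.  Conversely, let `D ⊆ C` present all elements of `C`.  If
`t ∈ C` is not in `D`, then `D ⊆ C \ {t}`, and since `D` presents `t`, so does `C \ {t}`.  Hence
`D` contains `irreducibles F C`, which is therefore the least subset of `C` that presents all of `C`.

This applies to the finite poset of embedded minors of a matroid `M` and the diagram of their
foundations.  The link with the canonical morphisms of the minors of `M` is that a minor embedding
of `N` into `M` identifies the embedded minors of `N`, up to isomorphism and compatibly with all
induced morphisms of foundations, with a lower set of embedded minors of `M`
(`MinorEmbedding.push`, `MinorEmbedding.restrict`).  Thus the canonical morphism of an embedded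
minor `N` of `M` is an isomorphism if and only if `N` is presented in the poset of `M`
(`MinorEmbedding.isIso_canonicalMap_iff`).  Applied to isomorphisms, the same fact shows that the
condition in the theorem depends only on the isomorphism type.
-/

noncomputable section

/-! ### Values of a diagram that are colimits of the values below them -/

namespace CategoryTheory

section Below

variable {P : Type u} [PartialOrder P] {𝒞 : Type v} [Category.{w} 𝒞]

/-- `F.obj t` is the colimit of the restriction of `F` to the elements of `S` below `t`, spelled
out as a universal property. -/
def IsColimitBelow (F : P ⥤ 𝒞) (S : Set P) (t : P) : Prop :=
  ∀ (Q : 𝒞) (φ : ∀ s, s ∈ S → s ≤ t → (F.obj s ⟶ Q)),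
    (∀ s s' (hs : s ∈ S) (hs' : s' ∈ S) (h : s ≤ s') (ht : s' ≤ t),
      F.map (homOfLE h) ≫ φ s' hs' ht = φ s hs (h.trans ht)) →
    ∃! ψ : F.obj t ⟶ Q, ∀ s (hs : s ∈ S) (h : s ≤ t), F.map (homOfLE h) ≫ ψ = φ s hs h

theorem map_homOfLE_comp (F : P ⥤ 𝒞) {a b c : P} (h : a ≤ b) (h' : b ≤ c) {Q : 𝒞}
    (ψ : F.obj c ⟶ Q) :
    F.map (homOfLE h) ≫ F.map (homOfLE h') ≫ ψ = F.map (homOfLE (h.trans h')) ≫ ψ := by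
  rw [← Category.assoc, ← F.map_comp]
  rfl

theorem map_homOfLE_refl (F : P ⥤ 𝒞) {a : P} (h : a ≤ a) : F.map (homOfLE h) = 𝟙 _ :=
  F.map_id a

/-- The value at an element of `S` is the colimit over a diagram with a terminal object. -/
theorem isColimitBelow_of_mem (F : P ⥤ 𝒞) {S : Set P} {t : P} (ht : t ∈ S) :
    IsColimitBelow F S t := by
  intro Q φ hφ
  refine ⟨φ t ht le_rfl, fun s hs h => hφ s t hs ht h le_rfl, fun ψ hψ => ?_⟩
  rw [← hψ t ht le_rfl, map_homOfLE_refl, Category.id_comp]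

/-- Transitivity of colimits: if every value on `T` is a colimit of values on `S`, then colimits
over `S` and over `T` agree. -/
theorem isColimitBelow_congr {F : P ⥤ 𝒞} {S T : Set P} {t : P}
    (hST : ∀ s ∈ S, s ≤ t → s ∈ T) (hT : ∀ x ∈ T, x ≤ t → IsColimitBelow F S x) :
    IsColimitBelow F S t ↔ IsColimitBelow F T t := by
  -- A morphism that is compatible with a family on `T` over `S` is compatible with it over `T`.
  have key : ∀ (Q : 𝒞) (φ : ∀ s, s ∈ T → s ≤ t → (F.obj s ⟶ Q)),
      (∀ s s' (hs : s ∈ T) (hs' : s' ∈ T) (h : s ≤ s') (ht : s' ≤ t),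
        F.map (homOfLE h) ≫ φ s' hs' ht = φ s hs (h.trans ht)) →
      ∀ ψ : F.obj t ⟶ Q,
        (∀ s (hs : s ∈ S) (h : s ≤ t), F.map (homOfLE h) ≫ ψ = φ s (hST s hs h) h) →
        ∀ x (hx : x ∈ T) (h : x ≤ t), F.map (homOfLE h) ≫ ψ = φ x hx h := by
    intro Q φ hφ ψ hψ x hx h
    refine (hT x hx h Q (fun s hs hsx => φ s (hST s hs (hsx.trans h)) (hsx.trans h))
      fun s s' hs hs' hss' hs'x => hφ _ _ _ _ _ _).unique ?_ ?_
    · intro s hs hsx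
      rw [map_homOfLE_comp, hψ s hs]
    · intro s hs hsx
      exact hφ _ _ _ _ _ _
  constructor
  · intro hS Q φ hφ
    obtain ⟨ψ, hψ, huniq⟩ := hS Q (fun s hs h => φ s (hST s hs h) h)
      fun s s' hs hs' h ht => hφ _ _ _ _ _ _
    exact ⟨ψ, key Q φ hφ ψ hψ, fun ψ' hψ' => huniq ψ' fun s hs h => hψ' s (hST s hs h) h⟩
  · intro hT' Q φ hφ
    -- Extend the family `φ` from `S` to `T` by the universal properties of the values on `T`.
    choose φ' hφ' huniq using fun x (hx : x ∈ T) (h : x ≤ t) =>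
      hT x hx h Q (fun s hs hsx => φ s hs (hsx.trans h))
        fun s s' hs hs' hss' hs'x => hφ _ _ _ _ _ _
    have hext : ∀ s (hs : s ∈ S) (h : s ≤ t), φ' s (hST s hs h) h = φ s hs h := by
      intro s hs h
      have := hφ' s (hST s hs h) h s hs le_rfl
      rwa [map_homOfLE_refl, Category.id_comp] at this
    have hcompat : ∀ s s' (hs : s ∈ T) (hs' : s' ∈ T) (h : s ≤ s') (ht : s' ≤ t),
        F.map (homOfLE h) ≫ φ' s' hs' ht = φ' s hs (h.trans ht) := by
      intro s s' hs hs' h ht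
      refine huniq s hs (h.trans ht) _ fun x hx hxs => ?_
      rw [map_homOfLE_comp]
      exact hφ' s' hs' ht x hx (hxs.trans h)
    obtain ⟨ψ, hψ, hψuniq⟩ := hT' Q φ' hcompat
    refine ⟨ψ, fun s hs h => (hψ s (hST s hs h) h).trans (hext s hs h), fun ψ' hψ' => ?_⟩
    exact hψuniq ψ' (key Q φ' hcompat ψ' fun s hs h => (hψ' s hs h).trans (hext s hs h).symm)

/-- The elements of `C` whose value is not the colimit of the values on the other elements of `C`
below them. -/
def irreducibles (F : P ⥤ 𝒞) (C : Set P) : Set P :=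
  {t | t ∈ C ∧ ¬ IsColimitBelow F (C \ {t}) t}

/-- The irreducible elements of `C` suffice to build all elements of `C`: reducible elements are
colimits of smaller elements of `C`, to which induction applies. -/
theorem isColimitBelow_irreducibles [WellFoundedLT P] (F : P ⥤ 𝒞) (C : Set P) :
    ∀ t ∈ C, IsColimitBelow F (irreducibles F C) t := by
  intro t
  induction t using WellFoundedLT.induction with
  | _ t ih =>
    intro ht
    by_cases h : t ∈ irreducibles F C
    · exact isColimitBelow_of_mem F h
    · have h' : IsColimitBelow F (C \ {t}) t := by
        by_contra hn
        exact h ⟨ht, hn⟩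
      refine (isColimitBelow_congr ?_ ?_).2 h'
      · intro s hs _
        exact ⟨hs.1, fun hst => h (hst ▸ hs)⟩
      · intro x hx hxt
        exact ih x (lt_of_le_of_ne hxt hx.2) hx.1

/-- Irreducible elements cannot be dispensed with: if `t` were missing from `D`, its value would be
a colimit of other values on `C`. -/
theorem irreducibles_subset {F : P ⥤ 𝒞} {C D : Set P} (hDC : D ⊆ C)
    (hD : ∀ t ∈ C, IsColimitBelow F D t) : irreducibles F C ⊆ D := by
  intro t ht
  by_contra htD
  refine ht.2 ((isColimitBelow_congr ?_ ?_).1 (hD t ht.1))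
  · intro s hs _
    exact ⟨hDC hs, fun hst => htD (hst ▸ hs)⟩
  · intro x hx _
    exact hD x hx.1

/-- Invariance under an isomorphism of diagrams over the inclusion of a lower set. -/
theorem isColimitBelow_iff_of_orderEmbedding {P' : Type u} [PartialOrder P'] {F : P ⥤ 𝒞}
    {F' : P' ⥤ 𝒞} (p : P ↪o P') (hp : ∀ x y, y ≤ p x → ∃ x', p x' = y)
    (η : ∀ a, F.obj a ≅ F'.obj (p a))
    (hη : ∀ a b (h : a ≤ b), F.map (homOfLE h) ≫ (η b).hom =
      (η a).hom ≫ F'.map (homOfLE (p.le_iff_le.2 h))) (S : Set P') (x : P) :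
    IsColimitBelow F (p ⁻¹' S) x ↔ IsColimitBelow F' S (p x) := by
  have nat : ∀ {a b : P} (h : a ≤ b) {Q : 𝒞} (ψ : F'.obj (p b) ⟶ Q),
      F.map (homOfLE h) ≫ (η b).hom ≫ ψ =
        (η a).hom ≫ F'.map (homOfLE (p.le_iff_le.2 h)) ≫ ψ := by
    intro a b h Q ψ
    rw [← Category.assoc, hη, Category.assoc]
  have nat' : ∀ {a b : P} (h : a ≤ b) {Q : 𝒞} (ψ : F.obj b ⟶ Q),
      F'.map (homOfLE (p.le_iff_le.2 h)) ≫ (η b).inv ≫ ψ =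
        (η a).inv ≫ F.map (homOfLE h) ≫ ψ := by
    intro a b h Q ψ
    rw [Iso.eq_inv_comp, ← nat, Iso.hom_inv_id_assoc]
  constructor
  · intro H Q φ hφ
    obtain ⟨ψ, hψ, huniq⟩ := H Q (fun s hs h => (η s).hom ≫ φ (p s) hs (p.le_iff_le.2 h))
      (fun s s' hs hs' h ht => by rw [nat, hφ])
    refine ⟨(η x).inv ≫ ψ, ?_, ?_⟩
    · intro y hy hyx
      obtain ⟨s, rfl⟩ := hp x y hyx
      rw [nat' (p.le_iff_le.1 hyx), hψ s hy, Iso.inv_hom_id_assoc]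
    · intro ψ' hψ'
      rw [← huniq ((η x).hom ≫ ψ') fun s hs h => by rw [nat, hψ'], Iso.inv_hom_id_assoc]
  · intro H Q φ hφ
    -- The transported family is indexed by the elements of `P'` below `p x`, which are only
    -- propositionally equal to values of `p`.
    obtain ⟨φ', hφ'⟩ : ∃ φ' : ∀ y, y ∈ S → y ≤ p x → (F'.obj y ⟶ Q),
        ∀ s (hs : p s ∈ S) (h : s ≤ x),
          φ' (p s) hs (p.le_iff_le.2 h) = (η s).inv ≫ φ s hs h := by
      choose g hg using hp x
      refine ⟨fun y hy hyx => F'.map (homOfLE (hg y hyx).ge) ≫ (η (g y hyx)).inv ≫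
        φ (g y hyx) (show p (g y hyx) ∈ S from (hg y hyx).symm ▸ hy)
          (p.le_iff_le.1 ((hg y hyx).le.trans hyx)), fun s hs h => ?_⟩
      have hs' : s ≤ g (p s) (p.le_iff_le.2 h) := p.le_iff_le.1 (hg _ _).ge
      exact (nat' hs' _).trans (by rw [hφ])
    obtain ⟨ψ, hψ, huniq⟩ := H Q φ' (fun y y' hy hy' h ht => by
      obtain ⟨s', rfl⟩ := hp x y' ht
      obtain ⟨s, rfl⟩ := hp x y (h.trans ht)
      rw [hφ' s' hy' (p.le_iff_le.1 ht), hφ' s hy (p.le_iff_le.1 (h.trans ht)),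
        nat' (p.le_iff_le.1 h), hφ])
    refine ⟨(η x).hom ≫ ψ, ?_, ?_⟩
    · intro s hs h
      rw [nat, hψ (p s) hs, hφ' s hs h, Iso.hom_inv_id_assoc]
    · intro ψ' hψ'
      rw [← huniq ((η x).inv ≫ ψ') ?_, Iso.hom_inv_id_assoc]
      intro y hy hyx
      obtain ⟨s, rfl⟩ := hp x y hyx
      rw [nat' (p.le_iff_le.1 hyx), hψ' s hy, hφ']

/-- If the leg of a cocone at the greatest element is an isomorphism, its point may serve as the
value at the greatest element. -/
theorem isIso_desc_iff_isColimitBelow {F : P ⥤ 𝒞} (c : Cocone F) {t : P} (ht : ∀ s, s ≤ t)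
    [IsIso (c.ι.app t)] (S : Set P)
    (hS : Monotone fun s : {s : P // s ∈ S} => s.1) [HasColimit (hS.functor ⋙ F)] :
    IsIso (colimit.desc (hS.functor ⋙ F) (c.whisker hS.functor)) ↔ IsColimitBelow F S t := by
  have hw : ∀ {s s' : P} (h : s ≤ s') {Q : 𝒞} (ψ : c.pt ⟶ Q),
      F.map (homOfLE h) ≫ c.ι.app s' ≫ ψ = c.ι.app s ≫ ψ := by
    intro s s' h Q ψ
    rw [← Category.assoc, c.w]
  have hw' : ∀ (s : P) {Q : 𝒞} (ψ : F.obj t ⟶ Q),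
      c.ι.app s ≫ inv (c.ι.app t) ≫ ψ = F.map (homOfLE (ht s)) ≫ ψ := by
    intro s Q ψ
    rw [← hw (ht s), IsIso.hom_inv_id_assoc]
  refine (IsColimit.nonempty_isColimit_iff_isIso_desc (colimit.isColimit _)).symm.trans ?_
  constructor
  · rintro ⟨hc⟩ Q φ hφ
    let d : Cocone (hS.functor ⋙ F) :=
      { pt := Q
        ι := { app := fun s => φ s.1 s.2 (ht _)
               naturality := fun s s' f =>
                (hφ s.1 s'.1 s.2 s'.2 (leOfHom f) (ht _)).trans (Category.comp_id _).symm } }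
    refine ⟨c.ι.app t ≫ hc.desc d, fun s hs h => ?_, fun ψ hψ => ?_⟩
    · rw [hw]
      exact hc.fac d ⟨s, hs⟩
    · have : inv (c.ι.app t) ≫ ψ = hc.desc d := by
        refine hc.uniq d _ fun s => ?_
        exact (hw' s.1 ψ).trans (hψ s.1 s.2 (ht _))
      rw [← this, IsIso.hom_inv_id_assoc]
  · intro H
    choose ψ hψ huniq using fun d : Cocone
        (hS.functor ⋙ F) =>
      H d.pt (fun s hs _ => d.ι.app ⟨s, hs⟩) fun s s' hs hs' h _ =>
        d.w (homOfLE (show (⟨s, hs⟩ : {s : P // s ∈ S}) ≤ ⟨s', hs'⟩ from h))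
    refine ⟨⟨fun d => inv (c.ι.app t) ≫ ψ d, fun d s => ?_, fun d m hm => ?_⟩⟩
    · exact (hw' s.1 _).trans (hψ d s.1 s.2 (ht _))
    · rw [← huniq d (c.ι.app t ≫ m) fun s hs h => ?_, IsIso.inv_hom_id_assoc]
      exact (hw h m).trans (hm ⟨s, hs⟩)

end Below

end CategoryTheory

/-! ### Minor embeddings and embedded minors -/

namespace Matroid

variable {α β : Type u} {N : Matroid α} {M : Matroid β}

namespace EmbeddedMinor

/-- The contracted set is contained in, and the deleted set is disjoint from, a common basis. -/
theorem exists_isBase (X : M.EmbeddedMinor) :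
    ∃ B, M.IsBase B ∧ X.con ⊆ B ∧ Disjoint B X.del := by
  obtain ⟨B, hB⟩ := X.toMatroid.exists_isBase
  have hBE := hB.subset_ground
  refine ⟨B ∪ X.con, (X.isBase_iff hBE).1 hB, Set.subset_union_right, ?_⟩
  exact Set.disjoint_union_left.2
    ⟨Set.disjoint_left.2 fun x hx => (mem_ground.1 (hBE hx)).2.1, X.disjoint.symm⟩

/-- The embedded minor that deletes `D` and contracts `K`.  A single basis that contains `K` and
avoids `D` witnesses both the independence of `K` and the coindependence of `D`. -/
def ofIsBase {D K B : Set β} (hD : D ⊆ M.E) (hB : M.IsBase B) (hK : K ⊆ B) (hBD : Disjoint B D) :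
    M.EmbeddedMinor where
  del := D
  con := K
  disjoint := (hBD.mono_left hK).symm
  coindep := coindep_iff_exists'.2 ⟨⟨B, hB, Set.subset_sdiff.2 ⟨hB.subset_ground, hBD⟩⟩, hD⟩
  indep := hB.indep.subset hK

instance : OrderTop M.EmbeddedMinor where
  top :=
    { del := ∅
      con := ∅
      disjoint := disjoint_bot_left
      coindep := M✶.empty_indep
      indep := M.empty_indep }
  le_top _ := ⟨Set.empty_subset _, Set.empty_subset _⟩

theorem toMatroid_eq_iff (X : M.EmbeddedMinor) : X.toMatroid = M ↔ X = ⊤ := by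
  constructor
  · intro h
    have key : ∀ x ∈ M.E, x ∉ X.del ∧ x ∉ X.con := fun x hx =>
      (mem_ground.1 (show x ∈ X.toMatroid.E by rwa [h])).2
    refine EmbeddedMinor.ext (Set.subset_empty_iff.1 fun x hx => ?_)
      (Set.subset_empty_iff.1 fun x hx => ?_)
    · exact (key x (X.coindep.subset_ground hx)).1 hx
    · exact (key x (X.indep.subset_ground hx)).2 hx
  · rintro rfl
    exact (contract_empty _).trans (delete_empty _)

instance [M.Finite] : Finite M.EmbeddedMinor := by
  have := (M.ground_finite.powerset).to_subtype
  refine Finite.of_injective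
    (fun X => (⟨X.del, X.coindep.subset_ground⟩, ⟨X.con, X.indep.subset_ground⟩) :
      M.EmbeddedMinor → M.E.powerset × M.E.powerset) fun X Y h => ?_
  exact EmbeddedMinor.ext (congrArg (fun p => p.1.1) h) (congrArg (fun p => p.2.1) h)

end EmbeddedMinor

namespace MinorEmbedding

/-- Every matroid as a minor of itself. -/
def refl (N : Matroid α) : N.MinorEmbedding N where
  toFun := id
  injective := Function.injective_id
  con := ∅
  notMem_con _ := Finset.notMem_empty _
  isBase_iff B := by simp

theorem con_eq_empty (e : N.MinorEmbedding M) (hs : Function.Surjective e.toFun) : e.con = ∅ := by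
  refine Finset.eq_empty_of_forall_notMem fun y hy => ?_
  obtain ⟨x, rfl⟩ := hs y
  exact e.notMem_con x hy

/-- A minor embedding that is surjective on ground sets is an isomorphism of matroids. This is its
inverse. -/
def symm (e : N.MinorEmbedding M) (hs : Function.Surjective e.toFun) :
    M.MinorEmbedding N where
  toFun := (Equiv.ofBijective e.toFun ⟨e.injective, hs⟩).symm
  injective := Equiv.injective _
  con := ∅
  notMem_con _ := Finset.notMem_empty _
  isBase_iff B := by
    rw [e.isBase_iff, e.con_eq_empty hs]
    simp only [Finset.coe_empty, Set.union_empty]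
    have : e.toFun '' ((Equiv.ofBijective e.toFun ⟨e.injective, hs⟩).symm '' B) = B :=
      (Equiv.ofBijective e.toFun ⟨e.injective, hs⟩).image_symm_image B
    rw [this]

theorem isIso_foundationMap (e : N.MinorEmbedding M) (hs : Function.Surjective e.toFun) :
    IsIso e.foundationMap := by
  refine ⟨(e.symm hs).foundationMap, ?_, ?_⟩
  · rw [foundationMap_comp e (e.symm hs) (refl N) ?_ ?_]
    · exact foundationMap_id _ (fun _ => rfl) rfl
    · exact fun x => ((Equiv.ofBijective e.toFun ⟨e.injective, hs⟩).symm_apply_apply x).symm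
    · intro y
      simp [e.con_eq_empty hs, symm, refl]
  · rw [foundationMap_comp (e.symm hs) e (refl M) ?_ ?_]
    · exact foundationMap_id _ (fun _ => rfl) rfl
    · exact fun x => ((Equiv.ofBijective e.toFun ⟨e.injective, hs⟩).apply_symm_apply x).symm
    · intro y
      simp [e.con_eq_empty hs, symm, refl]

theorem isomorphic (e : N.MinorEmbedding M) (hs : Function.Surjective e.toFun) :
    N.Isomorphic M := by
  have key : ∀ {α β : Type u} {N : Matroid α} {M : Matroid β} (e : N.MinorEmbedding M)
      (I : Set N.E), e.con = ∅ → N.Indep (Subtype.val '' I) →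
        M.Indep (Subtype.val '' (e.toFun '' I)) := by
    intro α β N M e I hc hI
    obtain ⟨B, hB, hIB⟩ := hI.exists_isBase_superset
    obtain ⟨B, rfl⟩ : ∃ B' : Set N.E, Subtype.val '' B' = B :=
      ⟨Subtype.val ⁻¹' B, Set.image_preimage_eq_of_subset (by simpa using hB.subset_ground)⟩
    rw [e.isBase_iff, hc, Finset.coe_empty, Set.union_empty] at hB
    exact hB.indep.subset (Set.image_mono (Set.image_mono
      ((Set.image_subset_image_iff Subtype.val_injective).1 hIB)))
  refine ⟨Equiv.ofBijective e.toFun ⟨e.injective, hs⟩,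
    fun I => ⟨key e I (e.con_eq_empty hs), fun h => ?_⟩⟩
  have := key (e.symm hs) _ rfl h
  have h' : (e.symm hs).toFun '' (Equiv.ofBijective e.toFun ⟨e.injective, hs⟩ '' I) = I :=
    (Equiv.ofBijective e.toFun ⟨e.injective, hs⟩).symm_image_image I
  rwa [h'] at this

theorem _root_.Matroid.Isomorphic.exists_minorEmbedding (h : N.Isomorphic M) :
    ∃ e : N.MinorEmbedding M, Function.Surjective e.toFun := by
  have key : ∀ {α β : Type u} {N : Matroid α} {M : Matroid β} (e : N.E ≃ M.E),
      (∀ I : Set N.E, N.Indep (Subtype.val '' I) ↔ M.Indep (Subtype.val '' (e '' I))) →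
      ∀ B : Set N.E, N.IsBase (Subtype.val '' B) → M.IsBase (Subtype.val '' (e '' B)) := by
    intro α β N M e he B hB
    rw [isBase_iff_maximal_indep] at hB ⊢
    refine ⟨(he B).1 hB.1, fun J hJ hBJ => ?_⟩
    obtain ⟨J, rfl⟩ : ∃ J' : Set N.E, Subtype.val '' (e '' J') = J := by
      refine ⟨e ⁻¹' (Subtype.val ⁻¹' J), ?_⟩
      rw [e.image_preimage]
      exact Set.image_preimage_eq_of_subset (by simpa using hJ.subset_ground)
    have h1 : B ⊆ J := (Set.image_subset_image_iff e.injective).1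
      ((Set.image_subset_image_iff Subtype.val_injective).1 hBJ)
    exact Set.image_mono (Set.image_mono ((Set.image_subset_image_iff Subtype.val_injective).1
      (hB.2 ((he J).2 hJ) (Set.image_mono h1))))
  obtain ⟨e, he⟩ := h
  refine ⟨⟨e, e.injective, ∅, fun _ => Finset.notMem_empty _, fun B => ?_⟩, e.surjective⟩
  rw [Finset.coe_empty, Set.union_empty]
  refine ⟨key e he B, fun h => ?_⟩
  have := key e.symm (fun I => by rw [he, e.image_symm_image]) _ h
  rwa [e.symm_image_image] at this

/-- The image of an embedded minor of `N` under a minor embedding `e` of `N` into `M`: the set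
contracted by `e` is contracted as well, and the elements deleted by `e`, which are those neither in
the range of `e` nor contracted, are deleted as well. -/
def push (e : N.MinorEmbedding M) (X : N.EmbeddedMinor) : M.EmbeddedMinor :=
  EmbeddedMinor.ofIsBase
    (D := Subtype.val '' (e.toFun '' (Subtype.val ⁻¹' X.del) ∪
      {y | y ∉ Set.range e.toFun ∧ y ∉ e.con}))
    (K := Subtype.val '' (e.toFun '' (Subtype.val ⁻¹' X.con) ∪ e.con))
    (B := Subtype.val '' (e.toFun '' (Subtype.val ⁻¹' X.exists_isBase.choose) ∪ e.con))
    (by rintro _ ⟨y, _, rfl⟩; exact y.2)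
    (by
      rw [← e.isBase_iff, Set.image_preimage_eq_of_subset]
      · exact X.exists_isBase.choose_spec.1
      · simpa using X.exists_isBase.choose_spec.1.subset_ground)
    (Set.image_mono (Set.union_subset_union_left _
      (Set.image_mono (Set.preimage_mono X.exists_isBase.choose_spec.2.1))))
    (by
      rw [Set.disjoint_image_iff Subtype.val_injective, Set.disjoint_left]
      rintro y (⟨x, hx, rfl⟩ | hy) (⟨x', hx', h⟩ | ⟨h1, h2⟩)
      · rw [e.injective h] at hx'
        exact Set.disjoint_left.1 X.exists_isBase.choose_spec.2.2 hx hx'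
      · exact h1 ⟨x, rfl⟩
      · exact e.notMem_con x' (h ▸ hy)
      · exact h2 hy)

theorem mem_push_del {e : N.MinorEmbedding M} {X : N.EmbeddedMinor} {y : M.E} :
    (y : β) ∈ (e.push X).del ↔
      (∃ x : N.E, (x : α) ∈ X.del ∧ e.toFun x = y) ∨ (y ∉ Set.range e.toFun ∧ y ∉ e.con) :=
  Subtype.val_injective.mem_set_image

theorem mem_push_con {e : N.MinorEmbedding M} {X : N.EmbeddedMinor} {y : M.E} :
    (y : β) ∈ (e.push X).con ↔ (∃ x : N.E, (x : α) ∈ X.con ∧ e.toFun x = y) ∨ y ∈ e.con :=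
  Subtype.val_injective.mem_set_image

theorem apply_mem_push_del {e : N.MinorEmbedding M} {X : N.EmbeddedMinor} {x : N.E} :
    (e.toFun x : β) ∈ (e.push X).del ↔ (x : α) ∈ X.del := by
  rw [mem_push_del]
  constructor
  · rintro (⟨x', hx', h⟩ | h)
    · exact e.injective h ▸ hx'
    · exact (h.1 ⟨x, rfl⟩).elim
  · exact fun h => Or.inl ⟨x, h, rfl⟩

theorem apply_mem_push_con {e : N.MinorEmbedding M} {X : N.EmbeddedMinor} {x : N.E} :
    (e.toFun x : β) ∈ (e.push X).con ↔ (x : α) ∈ X.con := by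
  rw [mem_push_con]
  constructor
  · rintro (⟨x', hx', h⟩ | h)
    · exact e.injective h ▸ hx'
    · exact (e.notMem_con x h).elim
  · exact fun h => Or.inl ⟨x, h, rfl⟩

theorem push_le_push {e : N.MinorEmbedding M} {X Y : N.EmbeddedMinor} :
    e.push X ≤ e.push Y ↔ X ≤ Y := by
  constructor
  · intro h
    refine ⟨fun x hx => ?_, fun x hx => ?_⟩
    · lift x to N.E using Y.coindep.subset_ground hx
      exact apply_mem_push_del.1 (h.1 (apply_mem_push_del.2 hx))
    · lift x to N.E using Y.indep.subset_ground hx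
      exact apply_mem_push_con.1 (h.2 (apply_mem_push_con.2 hx))
  · intro h
    refine ⟨fun y hy => ?_, fun y hy => ?_⟩
    · lift y to M.E using (e.push Y).coindep.subset_ground hy
      rw [mem_push_del] at hy ⊢
      exact hy.imp_left fun ⟨x, hx, hxy⟩ => ⟨x, h.1 hx, hxy⟩
    · lift y to M.E using (e.push Y).indep.subset_ground hy
      rw [mem_push_con] at hy ⊢
      exact hy.imp_left fun ⟨x, hx, hxy⟩ => ⟨x, h.2 hx, hxy⟩

/-- The order embedding `push` of embedded minors. -/
def pushEmbedding (e : N.MinorEmbedding M) : N.EmbeddedMinor ↪o M.EmbeddedMinor :=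
  OrderEmbedding.ofMapLEIff e.push fun _ _ => push_le_push

/-- The range of `push` is a lower set. -/
theorem exists_push_eq (e : N.MinorEmbedding M) (X : N.EmbeddedMinor) (Y : M.EmbeddedMinor)
    (h : Y ≤ e.push X) : ∃ X', e.push X' = Y := by
  obtain ⟨B, hB, hKB, hBD⟩ := Y.exists_isBase
  have hcon : ∀ y ∈ e.con, (y : β) ∈ Y.con := fun y hy => h.2 (mem_push_con.2 (Or.inr hy))
  have hdel : ∀ y : M.E, y ∉ Set.range e.toFun → y ∉ e.con → (y : β) ∈ Y.del :=
    fun y h1 h2 => h.1 (mem_push_del.2 (Or.inr ⟨h1, h2⟩))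
  -- A basis containing `Y.con` and avoiding `Y.del` is the image of a basis of `N` joined with the
  -- contracted set.
  have hB' : Subtype.val '' (e.toFun '' {x | (e.toFun x : β) ∈ B} ∪ e.con) = B := by
    ext y
    constructor
    · rintro ⟨y, ⟨x, hx, rfl⟩ | hy, rfl⟩
      · exact hx
      · exact hKB (hcon y hy)
    · intro hy
      lift y to M.E using hB.subset_ground hy
      rw [Subtype.val_injective.mem_set_image]
      by_cases h2 : y ∈ e.con
      · exact Or.inr h2
      · by_cases h1 : y ∈ Set.range e.toFun
        · obtain ⟨x, rfl⟩ := h1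
          exact Or.inl ⟨x, hy, rfl⟩
        · exact (Set.disjoint_left.1 hBD hy (hdel y h1 h2)).elim
  refine ⟨EmbeddedMinor.ofIsBase (D := Subtype.val '' {x | (e.toFun x : β) ∈ Y.del})
    (K := Subtype.val '' {x | (e.toFun x : β) ∈ Y.con})
    (B := Subtype.val '' {x | (e.toFun x : β) ∈ B}) (by rintro _ ⟨x, _, rfl⟩; exact x.2)
    ((e.isBase_iff _).2 (hB'.symm ▸ hB)) (Set.image_mono fun x hx => hKB hx)
    ((Set.disjoint_image_iff Subtype.val_injective).2
      (Set.disjoint_left.2 fun x hx hx' => Set.disjoint_left.1 hBD hx hx')), ?_⟩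
  refine EmbeddedMinor.ext (Set.ext fun y => ?_) (Set.ext fun y => ?_)
  · by_cases hy : y ∈ M.E
    swap
    · exact iff_of_false (fun h => hy (Coindep.subset_ground (EmbeddedMinor.coindep _) h))
        fun h => hy (Y.coindep.subset_ground h)
    lift y to M.E using hy
    rw [mem_push_del]
    constructor
    · rintro (⟨x, hx, rfl⟩ | h)
      · exact Subtype.val_injective.mem_set_image.1 hx
      · exact hdel y h.1 h.2
    · intro hy
      by_cases h1 : y ∈ Set.range e.toFun
      · obtain ⟨x, rfl⟩ := h1
        exact Or.inl ⟨x, Subtype.val_injective.mem_set_image.2 hy, rfl⟩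
      · exact Or.inr ⟨h1, fun h2 => Set.disjoint_left.1 Y.disjoint hy (hcon y h2)⟩
  · by_cases hy : y ∈ M.E
    swap
    · exact iff_of_false (fun h => hy (Indep.subset_ground (EmbeddedMinor.indep _) h))
        fun h => hy (Y.indep.subset_ground h)
    lift y to M.E using hy
    rw [mem_push_con]
    constructor
    · rintro (⟨x, hx, rfl⟩ | h)
      · exact Subtype.val_injective.mem_set_image.1 hx
      · exact hcon y h
    · intro hy
      by_cases h2 : y ∈ e.con
      · exact Or.inr h2
      · by_cases h1 : y ∈ Set.range e.toFun
        · obtain ⟨x, rfl⟩ := h1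
          exact Or.inl ⟨x, Subtype.val_injective.mem_set_image.2 hy, rfl⟩
        · exact (Set.disjoint_left.1 Y.disjoint (hdel y h1 h2) hy).elim

theorem apply_mem_push_ground {e : N.MinorEmbedding M} {X : N.EmbeddedMinor} {x : N.E} :
    (e.toFun x : β) ∈ (e.push X).toMatroid.E ↔ (x : α) ∈ X.toMatroid.E := by
  rw [EmbeddedMinor.mem_ground, EmbeddedMinor.mem_ground, apply_mem_push_del, apply_mem_push_con]
  simp

/-- A minor embedding `e` restricts to an isomorphism from an embedded minor to its image. -/
def restrict (e : N.MinorEmbedding M) (X : N.EmbeddedMinor) :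
    X.toMatroid.MinorEmbedding (e.push X).toMatroid where
  toFun x := ⟨e.toFun ⟨x, (EmbeddedMinor.mem_ground.1 x.2).1⟩, apply_mem_push_ground.2 x.2⟩
  injective x y h := by
    have := e.injective (Subtype.ext (congrArg (fun z : (e.push X).toMatroid.E => (z : β)) h))
    exact Subtype.ext (congrArg (fun z : N.E => (z : α)) this)
  con := ∅
  notMem_con _ := Finset.notMem_empty _
  isBase_iff B := by
    rw [X.isBase_iff (by rintro _ ⟨x, _, rfl⟩; exact x.2),
      (e.push X).isBase_iff (by rintro _ ⟨x, _, rfl⟩; exact x.2)]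
    have h1 : (Subtype.val '' B ∪ X.con : Set α) =
        Subtype.val '' {x : N.E | (x : α) ∈ Subtype.val '' B ∪ X.con} := by
      refine (Set.image_preimage_eq_of_subset (f := (Subtype.val : N.E → α)) ?_).symm
      rintro x (⟨x, _, rfl⟩ | hx)
      · exact ⟨⟨x, (EmbeddedMinor.mem_ground.1 x.2).1⟩, rfl⟩
      · exact ⟨⟨x, X.indep.subset_ground hx⟩, rfl⟩
    rw [h1, e.isBase_iff]
    refine iff_of_eq (congrArg M.IsBase (Set.ext fun y => ?_))
    by_cases hy : y ∈ M.E
    swap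
    · refine iff_of_false ?_ ?_
      · rintro ⟨y, _, rfl⟩
        exact hy y.2
      · rintro (⟨y, _, rfl⟩ | h)
        · exact hy (EmbeddedMinor.mem_ground.1 y.2).1
        · exact hy ((e.push X).indep.subset_ground h)
    lift y to M.E using hy
    rw [Subtype.val_injective.mem_set_image, Set.mem_union, Set.mem_union (y : β), mem_push_con,
      ← or_assoc]
    refine or_congr ?_ Iff.rfl
    constructor
    · rintro ⟨x, ⟨z, hz, hzx⟩ | hx, rfl⟩
      · refine Or.inl ⟨_, Or.inl ⟨z, hz, rfl⟩, ?_⟩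
        exact congrArg (fun x => (e.toFun x : β)) (Subtype.ext hzx)
      · exact Or.inr ⟨x, hx, rfl⟩
    · rintro (⟨_, ⟨z, hz, rfl⟩ | hz, h⟩ | ⟨x, hx, h⟩)
      · exact ⟨⟨z, (EmbeddedMinor.mem_ground.1 z.2).1⟩, Or.inl ⟨z, hz, rfl⟩, Subtype.ext h⟩
      · exact (Finset.notMem_empty _ (Finset.mem_coe.1 hz)).elim
      · exact ⟨x, Or.inr hx, h⟩

theorem restrict_surjective (e : N.MinorEmbedding M) (X : N.EmbeddedMinor) :
    Function.Surjective (e.restrict X).toFun := by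
  rintro ⟨y, hy⟩
  obtain ⟨hyM, hyd, hyc⟩ := EmbeddedMinor.mem_ground.1 hy
  lift y to M.E using hyM
  have h2 : y ∉ e.con := fun h => hyc (mem_push_con.2 (Or.inr h))
  have h1 : y ∈ Set.range e.toFun := by
    by_contra h
    exact hyd (mem_push_del.2 (Or.inr ⟨h, h2⟩))
  obtain ⟨x, rfl⟩ := h1
  exact ⟨⟨x, apply_mem_push_ground.1 hy⟩, rfl⟩

theorem push_top (e : N.MinorEmbedding M) (hs : Function.Surjective e.toFun) :
    e.push ⊤ = ⊤ := by
  refine EmbeddedMinor.ext (Set.subset_empty_iff.1 fun y hy => ?_)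
    (Set.subset_empty_iff.1 fun y hy => ?_)
  · lift y to M.E using (e.push ⊤).coindep.subset_ground hy
    obtain ⟨x, rfl⟩ := hs y
    exact apply_mem_push_del.1 hy
  · lift y to M.E using (e.push ⊤).indep.subset_ground hy
    obtain ⟨x, rfl⟩ := hs y
    exact apply_mem_push_con.1 hy

end MinorEmbedding

namespace EmbeddedMinor

variable [M.Finite]

theorem push_toAmbient_top (X : M.EmbeddedMinor) : X.toAmbient.push ⊤ = X := by
  have hr : ∀ y : M.E, y ∈ Set.range X.toAmbient.toFun ↔ (y : β) ∉ X.del ∧ (y : β) ∉ X.con := by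
    intro y
    constructor
    · rintro ⟨x, rfl⟩
      exact (mem_ground.1 x.2).2
    · exact fun h => ⟨⟨y, mem_ground.2 ⟨y.2, h⟩⟩, rfl⟩
  refine EmbeddedMinor.ext (Set.ext fun y => ?_) (Set.ext fun y => ?_)
  · by_cases hy : y ∈ M.E
    swap
    · exact iff_of_false (fun h => hy ((X.toAmbient.push ⊤).coindep.subset_ground h))
        fun h => hy (X.coindep.subset_ground h)
    lift y to M.E using hy
    rw [MinorEmbedding.mem_push_del, hr, mem_toAmbient_con]
    have : (y : β) ∈ X.del → (y : β) ∉ X.con := fun h => Set.disjoint_left.1 X.disjoint h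
    constructor
    · rintro (⟨x, hx, _⟩ | h)
      · exact hx.elim
      · tauto
    · tauto
  · by_cases hy : y ∈ M.E
    swap
    · exact iff_of_false (fun h => hy ((X.toAmbient.push ⊤).indep.subset_ground h))
        fun h => hy (X.indep.subset_ground h)
    lift y to M.E using hy
    rw [MinorEmbedding.mem_push_con, mem_toAmbient_con]
    constructor
    · rintro (⟨x, hx, _⟩ | h)
      · exact hx.elim
      · exact h
    · exact Or.inr

theorem toAmbient_top_surjective : Function.Surjective (⊤ : M.EmbeddedMinor).toAmbient.toFun :=
  fun y => ⟨⟨y, mem_ground.2 ⟨y.2, fun h => h, fun h => h⟩⟩, rfl⟩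

instance : IsIso (M.foundationCocone.ι.app ⊤) :=
  MinorEmbedding.isIso_foundationMap _ toAmbient_top_surjective

end EmbeddedMinor

/-! ### Canonical morphisms and isomorphism types -/

theorem isoType_eq_iff [N.Finite] [M.Finite] : N.isoType = M.isoType ↔ N.Isomorphic M :=
  Quotient.eq (r := FiniteMatroid.setoid)

variable [N.Finite] [M.Finite]

theorem isIso_canonicalMap_iff (S : Set M.EmbeddedMinor) :
    IsIso (M.canonicalMap S) ↔ IsColimitBelow M.foundationDiagram S ⊤ :=
  isIso_desc_iff_isColimitBelow M.foundationCocone (fun _ => le_top) S fun _ _ h => h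

/-- The isomorphisms between the foundations of embedded minors and of their images are natural. -/
theorem MinorEmbedding.incl_comp_restrict (e : N.MinorEmbedding M) {X Y : N.EmbeddedMinor}
    (h : X ≤ Y) :
    (EmbeddedMinor.incl h).foundationMap ≫ (e.restrict Y).foundationMap =
      (e.restrict X).foundationMap ≫
        (EmbeddedMinor.incl (push_le_push.2 h : e.push X ≤ e.push Y)).foundationMap := by
  have hle : e.push X ≤ e.push Y := push_le_push.2 h
  -- Both composites are induced by the restriction of `e` to a minor embedding of `X` into the
  -- image of `Y`.
  let d : X.toMatroid.MinorEmbedding (e.push Y).toMatroid :=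
    { toFun := fun x => (EmbeddedMinor.incl hle).toFun ((e.restrict X).toFun x)
      injective := (EmbeddedMinor.incl hle).injective.comp (e.restrict X).injective
      con := (EmbeddedMinor.incl hle).con
      notMem_con := fun x => (EmbeddedMinor.incl hle).notMem_con _
      isBase_iff := fun B => by
        rw [(e.restrict X).isBase_iff, show (e.restrict X).con = ∅ from rfl, Finset.coe_empty,
          Set.union_empty, (EmbeddedMinor.incl hle).isBase_iff, ← Set.image_comp]
        rfl }
  have hd : ∀ x, (e.restrict Y).toFun x ∈ d.con ↔ (x : α) ∈ X.con := by
    intro x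
    have h1 := EmbeddedMinor.mem_incl_con hle ((e.restrict Y).toFun x)
    have h2 := apply_mem_push_con (e := e) (X := X)
      (x := ⟨x, (EmbeddedMinor.mem_ground.1 x.2).1⟩)
    exact h1.trans h2
  have h1 : (EmbeddedMinor.incl h).foundationMap ≫ (e.restrict Y).foundationMap =
      d.foundationMap := by
    refine foundationMap_comp _ _ _ (fun _ => rfl) fun y => ?_
    obtain ⟨x, rfl⟩ := e.restrict_surjective Y y
    rw [hd]
    constructor
    · exact fun hx => Or.inr ⟨x, (EmbeddedMinor.mem_incl_con h x).2 hx, rfl⟩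
    · rintro (hx | ⟨x', hx', hxx'⟩)
      · exact (Finset.notMem_empty _ hx).elim
      · rw [← (e.restrict Y).injective hxx']
        exact (EmbeddedMinor.mem_incl_con h x').1 hx'
  have h2 : (e.restrict X).foundationMap ≫ (EmbeddedMinor.incl hle).foundationMap =
      d.foundationMap := by
    refine foundationMap_comp _ _ _ (fun _ => rfl) fun y => ⟨Or.inl, ?_⟩
    rintro (hy | ⟨x, hx, _⟩)
    · exact hy
    · exact (Finset.notMem_empty _ hx).elim
  exact h1.trans h2.symm

/-- Minor embeddings identify the embedded minors of `N`, with their foundations, with those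
embedded minors of `M` that are contained in the image of `N`. -/
theorem MinorEmbedding.isIso_canonicalMap_iff (e : N.MinorEmbedding M) (S : Set M.EmbeddedMinor) :
    IsIso (N.canonicalMap (e.push ⁻¹' S)) ↔
      IsColimitBelow M.foundationDiagram S (e.push ⊤) := by
  have hiso : ∀ X, IsIso (e.restrict X).foundationMap := fun X =>
    isIso_foundationMap _ (e.restrict_surjective X)
  refine (Matroid.isIso_canonicalMap_iff _).trans
    (isColimitBelow_iff_of_orderEmbedding (F := N.foundationDiagram) (F' := M.foundationDiagram)
      e.pushEmbedding (fun X Y h => e.exists_push_eq X Y h)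
      (fun X => @asIso _ _ _ _ (e.restrict X).foundationMap (hiso X)) ?_ S ⊤)
  exact fun X Y h => e.incl_comp_restrict h

theorem MinorEmbedding.isoType_push (e : N.MinorEmbedding M) (X : N.EmbeddedMinor) :
    (e.push X).toMatroid.isoType = X.toMatroid.isoType :=
  (isoType_eq_iff.2 ((e.restrict X).isomorphic (e.restrict_surjective X))).symm

theorem isoType_top : (⊤ : M.EmbeddedMinor).toMatroid.isoType = M.isoType :=
  isoType_eq_iff.2 (MinorEmbedding.isomorphic _ EmbeddedMinor.toAmbient_top_surjective)

theorem MinorEmbedding.isIso_canonicalMap_type_iff (e : N.MinorEmbedding M)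
    (D : Set MatroidType.{u}) :
    IsIso (N.canonicalMap (N.embeddedMinorsOfType D)) ↔
      IsColimitBelow M.foundationDiagram (M.embeddedMinorsOfType D) (e.push ⊤) := by
  rw [← e.isIso_canonicalMap_iff]
  have : e.push ⁻¹' M.embeddedMinorsOfType D = N.embeddedMinorsOfType D :=
    Set.ext fun X => by
      change (e.push X).toMatroid.isoType ∈ D ↔ X.toMatroid.isoType ∈ D
      rw [e.isoType_push]
  rw [this]

theorem MinorEmbedding.isIso_canonicalMap_proper_iff (e : N.MinorEmbedding M)
    (C : Set MatroidType.{u}) :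
    IsIso (N.canonicalMap (N.properEmbeddedMinorsOfType C)) ↔
      IsColimitBelow M.foundationDiagram (M.embeddedMinorsOfType C \ {e.push ⊤}) (e.push ⊤) := by
  rw [← e.isIso_canonicalMap_iff]
  have : e.push ⁻¹' (M.embeddedMinorsOfType C \ {e.push ⊤}) = N.properEmbeddedMinorsOfType C :=
    Set.ext fun X => by
      change (e.push X).toMatroid.isoType ∈ C ∧ ¬ e.pushEmbedding X = e.pushEmbedding ⊤ ↔
        X.toMatroid ≠ N ∧ X.toMatroid.isoType ∈ C
      rw [e.isoType_push, e.pushEmbedding.injective.eq_iff, Ne, X.toMatroid_eq_iff, and_comm]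
  rw [this]

theorem isIso_canonicalMap_proper_congr (C : Set MatroidType.{u})
    (h : N.isoType = M.isoType) :
    IsIso (N.canonicalMap (N.properEmbeddedMinorsOfType C)) ↔
      IsIso (M.canonicalMap (M.properEmbeddedMinorsOfType C)) := by
  obtain ⟨e, hs⟩ := (isoType_eq_iff.1 h).exists_minorEmbedding
  rw [e.isIso_canonicalMap_proper_iff, (MinorEmbedding.refl M).isIso_canonicalMap_proper_iff,
    e.push_top hs, (MinorEmbedding.refl M).push_top Function.surjective_id]

end Matroid

/-! ### The fundamental type -/

/-- The isomorphism types of those matroids in `C` whose foundation is not the colimit of the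
foundations of their proper embedded minors in `C`. -/
def fundamentalFamily (C : Set MatroidType.{u}) : Set MatroidType.{u} :=
  {τ | ∃ (α : Type u) (M : Matroid α) (_ : M.Finite), M.isoType = τ ∧ M.isoType ∈ C ∧
    ¬ IsIso (M.canonicalMap (M.properEmbeddedMinorsOfType C))}

section

variable {α : Type u} (M : Matroid α) [M.Finite]

theorem isoType_mem_fundamentalFamily_iff (C : Set MatroidType.{u}) :
    M.isoType ∈ fundamentalFamily C ↔ M.isoType ∈ C ∧
      ¬ IsIso (M.canonicalMap (M.properEmbeddedMinorsOfType C)) := by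
  constructor
  · rintro ⟨β, N, _, h, hC, hN⟩
    exact ⟨h ▸ hC, fun hM => hN ((Matroid.isIso_canonicalMap_proper_congr C h).2 hM)⟩
  · exact fun h => ⟨α, M, inferInstance, rfl, h⟩

/-- Irreducibility of an embedded minor of `M` depends only on its isomorphism type, and not on the
matroid `M` in which it is embedded. -/
theorem irreducibles_foundationDiagram (C : Set MatroidType.{u}) :
    irreducibles M.foundationDiagram (M.embeddedMinorsOfType C) =
      M.embeddedMinorsOfType (fundamentalFamily C) := by
  ext X
  change X.toMatroid.isoType ∈ C ∧ ¬ _ ↔ X.toMatroid.isoType ∈ fundamentalFamily C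
  rw [isoType_mem_fundamentalFamily_iff, X.toAmbient.isIso_canonicalMap_proper_iff,
    X.push_toAmbient_top]

end

theorem isLeast_fundamentalFamily (C : Set MatroidType.{u}) :
    IsLeast {D : Set MatroidType.{u} | D ⊆ C ∧ Presents D C} (fundamentalFamily C) := by
  refine ⟨⟨?_, ?_⟩, ?_⟩
  · rintro _ ⟨_, _, _, rfl, h, _⟩
    exact h
  · intro α M _ hM
    rw [Matroid.isIso_canonicalMap_iff, ← irreducibles_foundationDiagram]
    exact isColimitBelow_irreducibles _ _ _ (by
      rwa [← Matroid.isoType_top] at hM)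
  · -- Testing irreducibility of `M` takes place in the poset of its own embedded minors.
    rintro D ⟨hDC, hD⟩ _ ⟨α, M, hfin, rfl, hM⟩
    have := hfin
    have h : irreducibles M.foundationDiagram (M.embeddedMinorsOfType C) ⊆
        M.embeddedMinorsOfType D := by
      refine irreducibles_subset (fun X hX => hDC hX) fun X hX => ?_
      have := hD α X.toMatroid hX
      rwa [X.toAmbient.isIso_canonicalMap_type_iff, X.push_toAmbient_top] at this
    rw [irreducibles_foundationDiagram] at h
    have h' : (⊤ : M.EmbeddedMinor).toMatroid.isoType ∈ D := h (show _ ∈ fundamentalFamily C by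
      rw [Matroid.isoType_top]
      exact (isoType_mem_fundamentalFamily_iff M C).2 hM)
    rwa [Matroid.isoType_top] at h'

theorem isFundamentalType_iff (C D : Set MatroidType.{u}) :
    IsFundamentalType C D ↔ D = fundamentalFamily C := by
  have h := isLeast_fundamentalFamily C
  constructor
  · intro hD
    exact (hD.2 h.1 (h.2 hD.1)).antisymm (h.2 hD.1)
  · rintro rfl
    exact ⟨h.1, fun D hD _ => h.2 hD⟩

end

theorem mainTheorem6 (C : Set MatroidType.{u}) :
    (∃! D : Set MatroidType.{u}, IsFundamentalType C D) ∧
    ∀ D : Set MatroidType.{u}, IsFundamentalType C D →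
      ∀ (α : Type u) (M : Matroid α) [M.Finite],
        M.isoType ∈ D ↔ M.isoType ∈ C ∧
          ¬ IsIso (M.canonicalMap (M.properEmbeddedMinorsOfType C)) := by
  refine ⟨⟨fundamentalFamily C, (isFundamentalType_iff C _).2 rfl,
    fun D hD => (isFundamentalType_iff C D).1 hD⟩, ?_⟩
  intro D hD α M _
  rw [(isFundamentalType_iff C D).1 hD]
  exact isoType_mem_fundamentalFamily_iff M C
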